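/- Let $d\ge 1$ and $r\ge 2$ be integers, $V=\{1,\dots,d\}$, $\mathcal X=\{1,\dots,r\}$. For a probability distribution $Q$ on $\mathcal X\times\mathcal X$ with marginals $Q_1,Q_2$ write $I(Q)=\sum_{a,b}Q(a,b)\log\frac{Q(a,b)}{Q_1(a)Q_2(b)}$ (with $0\log 0=0$) for its mutual information. **Model.** Let $P$ be a probability distribution on $\mathcal X^d$ that is Markov on a forest (acyclic graph) $T_P=(V,E_P)$ with $k$ edges, i.e. $P(x_i\mid x_{\mathrm{nbd}(i)})=P(x_i\mid x_{V\setminus i})$ for all $i\in V$ and all $x$ for which $P(x_{V\setminus i})>0$, where $\mathrm{nbd}(i)$ is the set of neighbours of $i$ in $T_P$. Assume that $T_P$ is a minimal representation of $P$ (no graph with fewer edges on which $P$ is Markov exists), and that all node marginals $P_i$ $(i\in V)$ and all pairwise marginals $P_{i,j}$ $((i,j)\in E_P)$ are positive everywhere. **Algorithm $\mathsf{CLThres}$.** Given samples $\mathbf x^n=(\mathbf x_1,\dots,\mathbf x_n)\in(\mathcal X^d)^n$ and a threshold $\varepsilon_n\in\mathbb R$, let $\widehat P_{i,j}$ be the empirical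 distribution of the coordinates $(i,j)$. Choose a spanning tree of the complete graph on $V$ that maximizes the sum of the weights $I(\widehat P_{i,j})$ over its edges; list its edges $\widehat e_1,\dots,\widehat e_{d-1}$ so that $I(\widehat P_{\widehat e_1})\ge\dots\ge I(\widehat P_{\widehat e_{d-1}})$; choose $\widehat k_n\in\{0,\dots,d-1\}$ with $I(\widehat P_{\widehat e_{\widehat k_n}})\ge\varepsilon_n$ and $I(\widehat P_{\widehat e_{\widehat k_n+1}})\le\varepsilon_n$ (the first condition is void if $\widehat k_n=0$, the second if $\widehat k_n=d-1$); output the edge set $\widehat E_{\widehat k_n}(\mathbf x^n)=\{\widehat e_1,\dots,\widehat e_{\widehat k_n}\}$. All ties are broken arbitrarily. Let $\mathcal A_n=\{\mathbf x^n:\widehat E_{\widehat k_n}(\mathbf x^n)\ne E_P\}$ be the structure-error event and $P^n$ the $n$-fold product of $P$. Logarithms of probabilities take values in $[-\infty,0]$, with $\log 0=-\infty$. **Theorem (Error rate for structure learning).** 1. If $T_P$ is a proper forest ($k<d-1$), there is a constant $C_P\in(1,\infty)$, depending only on $P$, such that for every real sequence $(\varepsilon_n)$ with $\varepsilon_n\to0$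 and $n\varepsilon_n/\log n\to\infty$, and for every way of breaking ties, $$-C_P\le\liminf_{n\to\infty}\frac1{n\varepsilon_n}\log P^n(\mathcal A_n)\le\limsup_{n\to\infty}\frac1{n\varepsilon_n}\log P^n(\mathcal A_n)\le-1 .$$ 2. If $T_P$ is a tree ($k=d-1$), then for every such $(\varepsilon_n)$ and every way of breaking ties the limit $\lim_{n\to\infty}\frac1n\log P^n(\mathcal A_n)$ exists and is $<0$; it is finite if $d\ge2$ (for $d=1$ no error is possible and the limit is $-\infty$). That is, the error probability decays exponentially fast. -/

import Mathlib

open MeasureTheory Filter Topology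

namespace CLThres

/-! ### Graphical models

`V = Fin d` is the vertex set and `Fin r` is the alphabet. -/

/-- The marginal probability that the coordinates indexed by `S` take the values prescribed
by `x`. -/
noncomputable def marginal {d r : ℕ} (P : Measure (Fin d → Fin r)) (S : Set (Fin d))
    (x : Fin d → Fin r) : ℝ :=
  P.real {y | ∀ j ∈ S, y j = x j}

/-- Local Markov property: `P(x_i | x_{nbd(i)}) = P(x_i | x_{V \ i})` for every vertex `i` and
every `x` for which the (finer) conditioning event has positive probability. -/
def IsMarkovOn {d r : ℕ} (P : Measure (Fin d → Fin r)) (G : SimpleGraph (Fin d)) : Prop :=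
  ∀ (i : Fin d) (x : Fin d → Fin r), 0 < marginal P {i}ᶜ x →
    marginal P (insert i (G.neighborSet i)) x / marginal P (G.neighborSet i) x
      = marginal P Set.univ x / marginal P {i}ᶜ x

/-- `P` is a forest-structured distribution with (minimal) graph `G`, with positive node
marginals and positive pairwise marginals on the edges. -/
structure IsForestModel {d r : ℕ} (P : Measure (Fin d → Fin r)) (G : SimpleGraph (Fin d)) :
    Prop where
  acyclic : G.IsAcyclic
  markov : IsMarkovOn P G
  minimal : ∀ G' : SimpleGraph (Fin d), IsMarkovOn P G' → G.edgeSet.ncard ≤ G'.edgeSet.ncard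
  node_pos : ∀ (i : Fin d) (a : Fin r), 0 < P.real {x | x i = a}
  edge_pos : ∀ i j : Fin d, G.Adj i j → ∀ a b : Fin r, 0 < P.real {x | x i = a ∧ x j = b}

/-! ### The algorithm -/

/-- Mutual information of a distribution `Q` on pairs (with `0 log 0 = 0`). -/
noncomputable def mutualInfo {r : ℕ} (Q : Fin r → Fin r → ℝ) : ℝ :=
  ∑ a, ∑ b, Q a b * Real.log (Q a b / ((∑ b', Q a b') * (∑ a', Q a' b)))

/-- Pairwise empirical distribution (pairwise type) of the coordinates `i`, `j` in the samples
`x 0, …, x (n - 1)`. -/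
noncomputable def pairType {n d r : ℕ} (x : Fin n → Fin d → Fin r) (i j : Fin d)
    (a b : Fin r) : ℝ :=
  ((Finset.univ.filter fun l : Fin n => x l i = a ∧ x l j = b).card : ℝ) / n

theorem mutualInfo_pairType_comm {n d r : ℕ} (x : Fin n → Fin d → Fin r) (i j : Fin d) :
    mutualInfo (pairType x i j) = mutualInfo (pairType x j i) := by
  have h : ∀ a b, pairType x i j a b = pairType x j i b a := by
    intro a b
    simp only [pairType, and_comm]
  unfold mutualInfo
  simp only [h]
  rw [Finset.sum_comm]
  simp only [mul_comm]

/-- Empirical mutual information of an unordered pair of vertices. -/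
noncomputable def empMI {n d r : ℕ} (x : Fin n → Fin d → Fin r) : Sym2 (Fin d) → ℝ :=
  Sym2.lift ⟨fun i j => mutualInfo (pairType x i j), mutualInfo_pairType_comm x⟩

open Classical in
/-- Total weight of the edges of `T`. -/
noncomputable def graphWeight {d : ℕ} (w : Sym2 (Fin d) → ℝ) (T : SimpleGraph (Fin d)) : ℝ :=
  ∑ e ∈ T.edgeFinset, w e

/-- `T` is a maximum-weight spanning tree for the edge weights `w`. -/
def IsMaxSpanningTree {d : ℕ} (w : Sym2 (Fin d) → ℝ) (T : SimpleGraph (Fin d)) : Prop :=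
  T.IsTree ∧ ∀ T' : SimpleGraph (Fin d), T'.IsTree → graphWeight w T' ≤ graphWeight w T

/-- `F` is a possible output of the thresholded Chow-Liu algorithm on the samples `x` with
threshold `ε`: take a maximum-weight spanning tree `T` for the empirical mutual informations, list
its edges `e 0, …, e (d - 2)` in decreasing order of weight, choose `k` such that the `k`-th edge
`e (k - 1)` has weight at least `ε` and the next edge `e k` has weight at most `ε` (a condition on
an edge that does not exist, for `k = 0` or `k = d - 1`, is void), and keep the first `k` edges.
All ties are broken arbitrarily. -/
def IsOutput {n d r : ℕ} (x : Fin n → Fin d → Fin r) (ε : ℝ) (F : SimpleGraph (Fin d)) : Prop :=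
  ∃ T : SimpleGraph (Fin d), IsMaxSpanningTree (empMI x) T ∧
  ∃ e : Fin (d - 1) → Sym2 (Fin d),
    Function.Injective e ∧ Set.range e = T.edgeSet ∧ Antitone (fun j => empMI x (e j)) ∧
  ∃ k : ℕ, k ≤ d - 1 ∧
    (∀ j : Fin (d - 1), (j : ℕ) + 1 = k → ε ≤ empMI x (e j)) ∧
    (∀ j : Fin (d - 1), (j : ℕ) = k → empMI x (e j) ≤ ε) ∧
    F.edgeSet = {f | ∃ j : Fin (d - 1), (j : ℕ) < k ∧ e j = f}

/-- `Ehat` is an implementation of the algorithm with regularization sequence `ε`, that is, for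
every sample size and every data set it returns an output of the algorithm (with some way of
breaking the ties). -/
def IsImplementation {d r : ℕ} (ε : ℕ → ℝ)
    (Ehat : (n : ℕ) → (Fin n → Fin d → Fin r) → SimpleGraph (Fin d)) : Prop :=
  ∀ (n : ℕ) (x : Fin n → Fin d → Fin r), IsOutput x (ε n) (Ehat n x)

/-- The conditions on the regularization sequence. -/
def IsRegularization (ε : ℕ → ℝ) : Prop :=
  Tendsto ε atTop (𝓝 0) ∧ Tendsto (fun n : ℕ => n * ε n / Real.log n) atTop atTop

/-- `log P^n(A_n)`, an extended real number, where `A_n` is the event that the graph learned from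
`n` independent samples from `P` differs from `G`. -/
noncomputable def logErrorProb {d r : ℕ} (P : Measure (Fin d → Fin r)) (G : SimpleGraph (Fin d))
    (Ehat : (n : ℕ) → (Fin n → Fin d → Fin r) → SimpleGraph (Fin d)) (n : ℕ) : EReal :=
  ENNReal.log (Measure.pi (fun _ : Fin n => P) {x | Ehat n x ≠ G})

end CLThres

/-! By the method of types, the probability that the empirical law falls in a set of laws `q` is at
most a polynomial in `n` times `exp (-n * c)`, where `c` is a lower bound for the divergence `D(q ‖
P)` on that set. A change of measure gives bounds from below: an event that is typical under `q` has
`P`-probability about `exp (-n * D(q ‖ P))`. Everything is thus reduced to divergences of the laws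
that mislead the algorithm.

Cut optimality of maximum spanning trees (`IsOutput.eq_of_forall`) shows that there is no error when
(a) each edge `u v` of `G` has more information than every other pair separated by deleting `u v`,
(b) each edge of `G` is above the threshold, (c) each pair from different components of `G` is below
it. For `P` itself, (a) holds by strict data processing along paths, and edges have positive
information because otherwise they could be deleted, against minimality. Both rest on the global
Markov property, which needs `P` to be positive everywhere; positivity is obtained by peeling off
leaves.

The laws that violate (a), or give some edge information at most 0, form a compact set that does not
contain `P`, so their divergence from `P` is bounded away from 0; by compactness the small threshold
does not spoil this. A violation of (c) is cheaper: when `i` and `j` are independent under `P`,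
`I_q(i, j) ≤ D(q ‖ P)` (`pairInfo_le_relEntropy`), so it costs at least `ε_n`. This gives the limsup
bound for proper forests, the polynomial factor being absorbed because `n * ε_n / log n → ∞`.
Conversely the law `P * (1 + t f(x_i) g(x_j))` with `t ^ 2` of order `ε_n` has divergence of order
`ε_n` from `P` and makes the empirical information exceed `ε_n` with probability at least 1/2, hence
the finite `C_P`.

For a tree (c) is void, and the exponent is the minimal divergence `K` over the compact set. For the
matching lower bound, sampling from a minimizer leads to an error if it makes some edge independent.
If it only produces a tie, an arbitrarily small mixture with a resampled coordinate
(`exists_pairInfo_lt`) breaks the tie in the wrong direction. -/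

namespace CLThres

/-! ### Relative entropy on finite alphabets -/

section RelEntropy

variable {α : Type*} [Fintype α]

/-- Relative entropy of `q` with respect to `p` (with `0 log 0 = 0`). -/
noncomputable def relEntropy (q p : α → ℝ) : ℝ := ∑ a, q a * Real.log (q a / p a)

/-- Termwise `log t ≤ t - 1`. The second argument may have mass less than 1: most inequalities below
come from applying this to a tilted version of `p`. -/
theorem relEntropy_nonneg {q p : α → ℝ} (hq : q ∈ stdSimplex ℝ α) (hp : ∀ a, 0 ≤ p a)
    (hp1 : ∑ a, p a ≤ 1) (hqp : ∀ a, 0 < q a → 0 < p a) : 0 ≤ relEntropy q p := by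
  have h : ∀ a, q a - p a ≤ q a * Real.log (q a / p a) := by
    intro a
    rcases (hq.1 a).eq_or_lt with h0 | h0
    · simp [← h0, hp a]
    · have hpa := hqp a h0
      have h1 := Real.log_le_sub_one_of_pos (div_pos hpa h0)
      have h2 : Real.log (q a / p a) = -Real.log (p a / q a) := by
        rw [← Real.log_inv, inv_div]
      have h3 : q a * (p a / q a - 1) = p a - q a := by field_simp
      have h4 := mul_le_mul_of_nonneg_left h1 h0.le
      rw [h2]
      linarith
  have := Finset.sum_le_sum fun a (_ : a ∈ Finset.univ) => h a
  rw [Finset.sum_sub_distrib, hq.2] at this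
  unfold relEntropy
  linarith

/-- A form of Pinsker's inequality for bounded test functions. -/
theorem sq_sub_le_relEntropy {q p : α → ℝ} (hq : q ∈ stdSimplex ℝ α) (hp : p ∈ stdSimplex ℝ α)
    (hqp : ∀ a, 0 < q a → 0 < p a) {φ : α → ℝ} (hφ : ∀ a, |φ a| ≤ 1) :
    (∑ a, q a * φ a - ∑ a, p a * φ a) ^ 2 / 16 ≤ relEntropy q p := by
  have hbound : ∀ q ∈ stdSimplex ℝ α, |∑ a, q a * φ a| ≤ 1 := by
    intro q hq
    calc |∑ a, q a * φ a| ≤ ∑ a, |q a * φ a| := Finset.abs_sum_le_sum_abs _ _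
      _ ≤ ∑ a, q a := Finset.sum_le_sum fun a _ => by
          rw [abs_mul, abs_of_nonneg (hq.1 a)]
          exact mul_le_of_le_one_right (hq.1 a) (hφ a)
      _ = 1 := hq.2
  set m := ∑ a, p a * φ a with hm
  set Δ := ∑ a, q a * φ a - m with hΔ
  have hm1 := abs_le.1 (hbound p hp)
  have hq1 := abs_le.1 (hbound q hq)
  rw [← hm] at hm1
  have hΔ2 : |Δ| ≤ 2 := abs_le.2 ⟨by linarith, by linarith⟩
  -- Variational bound with a centered exponential tilt: the slope `Δ / 8` keeps `|h| ≤ 1/2`, so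
  -- `exp h ≤ 1 + h + h ^ 2`, and `p * exp (h - Δ ^ 2 / 16)` has mass at most 1. The gain is `Δ ^ 2
  -- / 8 - Δ ^ 2 / 16`.
  set h : α → ℝ := fun a => Δ / 8 * (φ a - m) with hh
  have hh1 : ∀ a, |h a| ≤ |Δ| / 4 := by
    intro a
    have := abs_le.1 (hφ a)
    have h2 : |φ a - m| ≤ 2 := abs_le.2 ⟨by linarith, by linarith⟩
    rw [hh, abs_mul, abs_div, abs_of_pos (by norm_num : (0 : ℝ) < 8)]
    nlinarith [abs_nonneg Δ]
  have hsq : ∀ a, h a ^ 2 ≤ Δ ^ 2 / 16 := by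
    intro a
    have := pow_le_pow_left₀ (abs_nonneg _) (hh1 a) 2
    rw [sq_abs, div_pow, sq_abs] at this
    linarith
  have hexp : ∀ a, Real.exp (h a) ≤ 1 + h a + Δ ^ 2 / 16 := by
    intro a
    have h1 := Real.abs_exp_sub_one_sub_id_le (x := h a) ((hh1 a).trans (by linarith))
    linarith [(abs_le.1 h1).2, hsq a]
  have hph : ∑ a, p a * h a = 0 := by
    have : ∑ a, p a * h a = Δ / 8 * (∑ a, p a * φ a - m * ∑ a, p a) := by
      rw [Finset.mul_sum, ← Finset.sum_sub_distrib, Finset.mul_sum]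
      exact Finset.sum_congr rfl fun a _ => by simp only [hh]; ring
    rw [this, hp.2, ← hm]; ring
  have hqh : ∑ a, q a * h a = Δ ^ 2 / 8 := by
    have : ∑ a, q a * h a = Δ / 8 * (∑ a, q a * φ a - m * ∑ a, q a) := by
      rw [Finset.mul_sum, ← Finset.sum_sub_distrib, Finset.mul_sum]
      exact Finset.sum_congr rfl fun a _ => by simp only [hh]; ring
    rw [this, hq.2, mul_one, ← hΔ]; ring
  have key := relEntropy_nonneg (p := fun a => p a * Real.exp (h a - Δ ^ 2 / 16)) hq
    (fun a => mul_nonneg (hp.1 a) (Real.exp_pos _).le) ?_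
    (fun a ha => mul_pos (hqp a ha) (Real.exp_pos _))
  · have hsplit : relEntropy q (fun a => p a * Real.exp (h a - Δ ^ 2 / 16))
        = relEntropy q p - ∑ a, q a * h a + Δ ^ 2 / 16 * ∑ a, q a := by
      unfold relEntropy
      rw [Finset.mul_sum, ← Finset.sum_sub_distrib, ← Finset.sum_add_distrib]
      refine Finset.sum_congr rfl fun a _ => ?_
      rcases (hq.1 a).eq_or_lt with h0 | h0
      · simp [← h0]
      · have hpa := hqp a h0
        rw [← div_div, Real.log_div (div_pos h0 hpa).ne' (Real.exp_pos _).ne', Real.log_exp]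
        ring
    rw [hsplit, hqh, hq.2] at key
    linarith
  · calc ∑ a, p a * Real.exp (h a - Δ ^ 2 / 16)
        = Real.exp (-(Δ ^ 2 / 16)) * ∑ a, p a * Real.exp (h a) := by
          rw [Finset.mul_sum]
          refine Finset.sum_congr rfl fun a _ => ?_
          rw [sub_eq_add_neg, Real.exp_add]; ring
      _ ≤ Real.exp (-(Δ ^ 2 / 16)) * ∑ a, (p a + p a * h a + Δ ^ 2 / 16 * p a) := by
          refine mul_le_mul_of_nonneg_left (Finset.sum_le_sum fun a _ => ?_) (Real.exp_pos _).le
          have := mul_le_mul_of_nonneg_left (hexp a) (hp.1 a)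
          linarith
      _ = Real.exp (-(Δ ^ 2 / 16)) * (1 + Δ ^ 2 / 16) := by
          rw [Finset.sum_add_distrib, Finset.sum_add_distrib, hph, ← Finset.mul_sum, hp.2]; ring
      _ ≤ Real.exp (-(Δ ^ 2 / 16)) * Real.exp (Δ ^ 2 / 16) := by
          refine mul_le_mul_of_nonneg_left ?_ (Real.exp_pos _).le
          linarith [Real.add_one_le_exp (Δ ^ 2 / 16)]
      _ = 1 := by rw [← Real.exp_add]; simp

theorem sq_apply_sub_le_relEntropy [DecidableEq α] {q p : α → ℝ} (hq : q ∈ stdSimplex ℝ α)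
    (hp : p ∈ stdSimplex ℝ α) (hqp : ∀ a, 0 < q a → 0 < p a) (a : α) :
    (q a - p a) ^ 2 / 16 ≤ relEntropy q p := by
  have := sq_sub_le_relEntropy hq hp hqp (φ := fun b => if b = a then 1 else 0)
    (fun b => by split_ifs <;> simp)
  simpa using this

theorem eq_of_relEntropy_nonpos {q p : α → ℝ} (hq : q ∈ stdSimplex ℝ α)
    (hp : p ∈ stdSimplex ℝ α) (hqp : ∀ a, 0 < q a → 0 < p a) (h : relEntropy q p ≤ 0) : q = p := by
  classical
  ext a
  have := sq_apply_sub_le_relEntropy hq hp hqp a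
  have h2 : (q a - p a) ^ 2 = 0 := le_antisymm (by linarith) (sq_nonneg _)
  exact sub_eq_zero.1 (pow_eq_zero_iff (by norm_num) |>.1 h2)

/-- In this form continuity in `q` is visible also where `q` vanishes. -/
theorem relEntropy_eq_negMulLog {q p : α → ℝ} (hp : ∀ a, 0 < p a) :
    relEntropy q p = ∑ a, (-Real.negMulLog (q a) - q a * Real.log (p a)) := by
  refine Finset.sum_congr rfl fun a _ => ?_
  rcases eq_or_ne (q a) 0 with h0 | h0
  · simp [h0]
  · rw [Real.log_div h0 (hp a).ne', Real.negMulLog]; ring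

theorem continuous_relEntropy {p : α → ℝ} (hp : ∀ a, 0 < p a) :
    Continuous fun q : α → ℝ => relEntropy q p := by
  simp only [relEntropy_eq_negMulLog hp]
  fun_prop

end RelEntropy

/-! ### Independent samples from a finite alphabet -/

section Samples

variable {α : Type*} [Fintype α] [DecidableEq α]

/-- Probability of a set of samples when the samples are independent with distribution `p`. -/
noncomputable def sampleProb {n : ℕ} (p : α → ℝ) (S : Set (Fin n → α)) : ℝ :=
  ∑ x, S.indicator (fun x => ∏ l, p (x l)) x

/-- Empirical distribution of a sample. -/
noncomputable def empirical {n : ℕ} (x : Fin n → α) (a : α) : ℝ :=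
  ((Finset.univ.filter fun l => x l = a).card : ℝ) / n

omit [Fintype α] in
theorem empirical_nonneg {n : ℕ} (x : Fin n → α) (a : α) : 0 ≤ empirical x a := by
  unfold empirical; positivity

theorem sum_empirical_mul {n : ℕ} (x : Fin n → α) (φ : α → ℝ) :
    ∑ a, empirical x a * φ a = (∑ l, φ (x l)) / n := by
  have h : ∑ l, φ (x l) = ∑ a, ((Finset.univ.filter fun l => x l = a).card : ℝ) * φ a := by
    rw [← Finset.sum_fiberwise Finset.univ x]
    refine Finset.sum_congr rfl fun a _ => ?_
    rw [Finset.sum_congr rfl (g := fun _ => φ a) fun l hl => by rw [(Finset.mem_filter.1 hl).2]]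
    simp
  rw [h, Finset.sum_div]
  exact Finset.sum_congr rfl fun a _ => by unfold empirical; ring

theorem empirical_mem_stdSimplex {n : ℕ} (hn : n ≠ 0) (x : Fin n → α) :
    empirical x ∈ stdSimplex ℝ α := by
  refine ⟨empirical_nonneg x, ?_⟩
  have := sum_empirical_mul x (fun _ => 1)
  simp only [mul_one] at this
  rw [this]
  simp [hn]

omit [Fintype α] in
theorem empirical_pos {n : ℕ} (x : Fin n → α) (l : Fin n) : 0 < empirical x (x l) := by
  have hn : 0 < n := l.pos
  have : 0 < (Finset.univ.filter fun l' => x l' = x l).card :=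
    Finset.card_pos.2 ⟨l, by simp⟩
  unfold empirical
  positivity

omit [Fintype α] in
theorem exists_eq_of_empirical_pos {n : ℕ} (x : Fin n → α) {a : α} (h : 0 < empirical x a) :
    ∃ l, x l = a := by
  by_contra hcon
  push Not at hcon
  simp [empirical, hcon] at h

omit [DecidableEq α] in
theorem sum_prod_eq_one {p : α → ℝ} (hp : p ∈ stdSimplex ℝ α) (n : ℕ) :
    ∑ x : Fin n → α, ∏ l, p (x l) = 1 := by
  classical
  have := Finset.prod_univ_sum (fun _ : Fin n => (Finset.univ : Finset α)) (fun _ a => p a)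
  rw [Fintype.piFinset_univ] at this
  rw [← this]
  simp [hp.2]

omit [DecidableEq α] in
theorem sampleProb_nonneg {n : ℕ} {p : α → ℝ} (hp : ∀ a, 0 ≤ p a) (S : Set (Fin n → α)) :
    0 ≤ sampleProb p S :=
  Finset.sum_nonneg fun _ _ => Set.indicator_nonneg (fun _ _ => Finset.prod_nonneg fun _ _ => hp _) _

omit [DecidableEq α] in
theorem sampleProb_mono {n : ℕ} {p : α → ℝ} (hp : ∀ a, 0 ≤ p a) {S S' : Set (Fin n → α)}
    (h : S ⊆ S') : sampleProb p S ≤ sampleProb p S' :=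
  Finset.sum_le_sum fun _ _ => Set.indicator_le_indicator_of_subset h
    (fun _ => Finset.prod_nonneg fun _ _ => hp _) _

omit [DecidableEq α] in
theorem sampleProb_compl {n : ℕ} {p : α → ℝ} (hp : p ∈ stdSimplex ℝ α) (S : Set (Fin n → α)) :
    sampleProb p S + sampleProb p Sᶜ = 1 := by
  unfold sampleProb
  rw [← Finset.sum_add_distrib, ← sum_prod_eq_one hp n]
  exact Finset.sum_congr rfl fun x _ => Set.indicator_self_add_compl_apply _ _ _

/-- An empirical law is determined by its counts, each of which lies in `{0, …, n}`. -/
theorem card_image_empirical_le (n : ℕ) :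
    ((Finset.univ : Finset (Fin n → α)).image empirical).card ≤ (n + 1) ^ Fintype.card α := by
  have hlt : ∀ (x : Fin n → α) (a : α),
      (Finset.univ.filter fun l => x l = a).card < n + 1 := fun x a =>
    Nat.lt_succ_of_le ((Finset.card_filter_le _ _).trans (by simp))
  let c : (Fin n → α) → α → Fin (n + 1) := fun x a => ⟨_, hlt x a⟩
  have h : (Finset.univ : Finset (Fin n → α)).image empirical
      ⊆ (Finset.univ : Finset (α → Fin (n + 1))).image fun k a => ((k a : ℕ) : ℝ) / n := by
    intro t ht
    obtain ⟨x, -, rfl⟩ := Finset.mem_image.1 ht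
    exact Finset.mem_image.2 ⟨c x, Finset.mem_univ _, rfl⟩
  refine (Finset.card_le_card h).trans (Finset.card_image_le.trans ?_)
  simp

/-- Probability of one sample in terms of its empirical distribution. -/
theorem prod_eq_exp_relEntropy {n : ℕ} (hn : n ≠ 0) {p : α → ℝ} (x : Fin n → α)
    (hpos : ∀ l, 0 < p (x l)) :
    ∏ l, p (x l) = Real.exp (-(n * relEntropy (empirical x) p)) * ∏ l, empirical x (x l) := by
  have hn' : (n : ℝ) ≠ 0 := Nat.cast_ne_zero.2 hn
  have h : -(n * relEntropy (empirical x) p)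
      = ∑ l, Real.log (p (x l) / empirical x (x l)) := by
    unfold relEntropy
    rw [sum_empirical_mul x fun a => Real.log (empirical x a / p a), mul_div_cancel₀ _ hn',
      ← Finset.sum_neg_distrib]
    exact Finset.sum_congr rfl fun l _ => by rw [← Real.log_inv, inv_div]
  rw [h, Real.exp_sum, ← Finset.prod_mul_distrib]
  refine Finset.prod_congr rfl fun l _ => ?_
  rw [Real.exp_log (div_pos (hpos l) (empirical_pos x l)),
    div_mul_cancel₀ _ (empirical_pos x l).ne']

/-- Sanov's upper bound. -/
theorem sampleProb_le_of_relEntropy {n : ℕ} (hn : n ≠ 0) {p : α → ℝ} (hp : ∀ a, 0 ≤ p a)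
    {S : Set (Fin n → α)} {c : ℝ}
    (hS : ∀ x ∈ S, (∀ a, 0 < empirical x a → 0 < p a) → c ≤ relEntropy (empirical x) p) :
    sampleProb p S ≤ ((n : ℝ) + 1) ^ Fintype.card α * Real.exp (-(n * c)) := by
  have h1 : ∀ x, S.indicator (fun x => ∏ l, p (x l)) x
      ≤ Real.exp (-(n * c)) * ∏ l, empirical x (x l) := by
    intro x
    have h0 : 0 ≤ Real.exp (-(n * c)) * ∏ l, empirical x (x l) :=
      mul_nonneg (Real.exp_pos _).le (Finset.prod_nonneg fun l _ => empirical_nonneg _ _)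
    by_cases hx : x ∈ S
    · rw [Set.indicator_of_mem hx]
      by_cases hpos : ∀ l, 0 < p (x l)
      · rw [prod_eq_exp_relEntropy hn x hpos]
        refine mul_le_mul_of_nonneg_right (Real.exp_le_exp.2 ?_)
          (Finset.prod_nonneg fun l _ => empirical_nonneg _ _)
        refine neg_le_neg (mul_le_mul_of_nonneg_left (hS x hx fun a ha => ?_) (Nat.cast_nonneg n))
        obtain ⟨l, rfl⟩ := exists_eq_of_empirical_pos x ha
        exact hpos l
      · push Not at hpos
        obtain ⟨l, hl⟩ := hpos
        rw [Finset.prod_eq_zero (Finset.mem_univ l) (le_antisymm hl (hp _))]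
        exact h0
    · rw [Set.indicator_of_notMem hx]
      exact h0
  -- Grouped by type, the sum over one type class is the probability of that class under its own
  -- type, hence at most 1; only the number of types remains.
  have h2 : ∑ x : Fin n → α, ∏ l, empirical x (x l)
      ≤ ((Finset.univ : Finset (Fin n → α)).image empirical).card := by
    have hcard : ∀ x ∈ (Finset.univ : Finset (Fin n → α)),
        empirical x ∈ (Finset.univ : Finset (Fin n → α)).image empirical :=
      fun x hx => Finset.mem_image_of_mem _ hx
    rw [← Finset.sum_fiberwise_of_maps_to hcard, ← nsmul_one, ← Finset.sum_const]
    refine Finset.sum_le_sum fun t ht => ?_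
    obtain ⟨x₀, -, rfl⟩ := Finset.mem_image.1 ht
    rw [← sum_prod_eq_one (empirical_mem_stdSimplex hn x₀) n]
    rw [Finset.sum_congr rfl (g := fun x => ∏ l, empirical x₀ (x l))
      fun x hx => by rw [(Finset.mem_filter.1 hx).2]]
    exact Finset.sum_le_sum_of_subset_of_nonneg (Finset.filter_subset _ _)
      fun x _ _ => Finset.prod_nonneg fun l _ => empirical_nonneg _ _
  calc sampleProb p S ≤ ∑ x, Real.exp (-(n * c)) * ∏ l, empirical x (x l) :=
        Finset.sum_le_sum fun x _ => h1 x
    _ = (∑ x : Fin n → α, ∏ l, empirical x (x l)) * Real.exp (-(n * c)) := by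
        rw [← Finset.mul_sum, mul_comm]
    _ ≤ _ := by
        refine mul_le_mul_of_nonneg_right (h2.trans ?_) (Real.exp_pos _).le
        exact_mod_cast card_image_empirical_le n

omit [DecidableEq α] in
theorem sum_prod_mul_apply {q : α → ℝ} (hq : q ∈ stdSimplex ℝ α) {n : ℕ} (φ : α → ℝ) (l : Fin n) :
    ∑ x : Fin n → α, (∏ m, q (x m)) * φ (x l) = ∑ a, q a * φ a := by
  classical
  have := Finset.prod_univ_sum (fun _ : Fin n => (Finset.univ : Finset α))
    (fun m a => q a * if m = l then φ a else 1)
  rw [Fintype.piFinset_univ] at this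
  have h1 : ∀ x : Fin n → α, (∏ m, q (x m)) * φ (x l)
      = ∏ m, (q (x m) * if m = l then φ (x m) else 1) := by
    intro x
    rw [Finset.prod_mul_distrib, Finset.prod_ite_eq' Finset.univ l]
    simp
  simp only [h1]
  rw [← this, Finset.prod_eq_single l]
  · simp
  · intro m _ hm
    simp [hm, hq.2]
  · simp

omit [DecidableEq α] in
/-- Change of measure. -/
theorem neg_mul_log_sampleProb_le {n : ℕ} {p q : α → ℝ} (hp : p ∈ stdSimplex ℝ α)
    (hq : q ∈ stdSimplex ℝ α) (hpos : ∀ a, 0 < p a) {S : Set (Fin n → α)} (hS : S.Nonempty) :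
    -(sampleProb q S * Real.log (sampleProb p S)) ≤ n * relEntropy q p + Real.log 2 := by
  classical
  have hPpos : ∀ x : Fin n → α, 0 < ∏ l, p (x l) := fun x => Finset.prod_pos fun l _ => hpos _
  have hSpos : 0 < sampleProb p S := by
    obtain ⟨x, hx⟩ := hS
    refine Finset.sum_pos' (fun y _ => Set.indicator_nonneg (fun z _ => (hPpos z).le) _)
      ⟨x, Finset.mem_univ _, ?_⟩
    rw [Set.indicator_of_mem hx]
    exact hPpos x
  set π := sampleProb p S with hπ
  -- `R` reweights the product law so that `S` gets mass 1/2 and the total is at most 1.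
  -- Nonnegativity of the divergence of `q`'s product law from `R` is the claim; the two factors 1/2
  -- produce `log 2`.
  set R : (Fin n → α) → ℝ := fun x => (∏ l, p (x l)) * if x ∈ S then 1 / (2 * π) else 1 / 2 with hR
  have hRpos : ∀ x, 0 < R x := fun x => mul_pos (hPpos x) (by split_ifs <;> positivity)
  have hR1 : ∑ x, R x ≤ 1 := by
    have h : ∀ x, R x = 1 / (2 * π) * S.indicator (fun x => ∏ l, p (x l)) x
        + 1 / 2 * Sᶜ.indicator (fun x => ∏ l, p (x l)) x := by
      intro x
      by_cases hx : x ∈ S <;> simp [hR, hx] <;> ring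
    simp only [h]
    rw [Finset.sum_add_distrib, ← Finset.mul_sum, ← Finset.mul_sum]
    change 1 / (2 * π) * π + 1 / 2 * sampleProb p Sᶜ ≤ 1
    have hc := sampleProb_compl hp S
    rw [← hπ] at hc
    have : 1 / (2 * π) * π = 1 / 2 := by field_simp
    rw [this]
    linarith
  have hQ : (fun x : Fin n → α => ∏ l, q (x l)) ∈ stdSimplex ℝ (Fin n → α) :=
    ⟨fun x => Finset.prod_nonneg fun l _ => hq.1 _, sum_prod_eq_one hq n⟩
  have key := relEntropy_nonneg hQ (fun x => (hRpos x).le) hR1 (fun x _ => hRpos x)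
  have hterm : ∀ x : Fin n → α,
      (∏ l, q (x l)) * Real.log ((∏ l, q (x l)) / R x)
        = ∑ l, (∏ m, q (x m)) * Real.log (q (x l) / p (x l))
          + Real.log π * S.indicator (fun x => ∏ l, q (x l)) x
          + Real.log 2 * ∏ l, q (x l) := by
    intro x
    rcases (hQ.1 x).eq_or_lt with h0 | h0
    · have h0' : ∏ l, q (x l) = 0 := h0.symm
      have : S.indicator (fun x => ∏ l, q (x l)) x = 0 := by
        by_cases hx : x ∈ S <;> simp [hx, h0']
      rw [this]
      simp [h0']
    · have hql : ∀ l, 0 < q (x l) := fun l =>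
        (hq.1 _).lt_of_ne fun h => h0.ne' (Finset.prod_eq_zero (Finset.mem_univ l) h.symm)
      have hlog : Real.log ((∏ l, q (x l)) / ∏ l, p (x l)) = ∑ l, Real.log (q (x l) / p (x l)) := by
        rw [← Finset.prod_div_distrib, Real.log_prod fun l _ => (div_pos (hql l) (hpos _)).ne']
      simp only [hR]
      rw [← div_div, Real.log_div (div_pos h0 (hPpos x)).ne' (by split_ifs <;> positivity), hlog,
        ← Finset.mul_sum]
      by_cases hx : x ∈ S
      · rw [if_pos hx, Set.indicator_of_mem hx, one_div, Real.log_inv,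
          Real.log_mul two_ne_zero hSpos.ne']
        ring
      · rw [if_neg hx, Set.indicator_of_notMem hx, one_div, Real.log_inv]
        ring
  unfold relEntropy at key
  simp only [hterm] at key
  rw [Finset.sum_add_distrib, Finset.sum_add_distrib, ← Finset.mul_sum, ← Finset.mul_sum,
    sum_prod_eq_one hq n, Finset.sum_comm] at key
  simp only [sum_prod_mul_apply hq fun a => Real.log (q a / p a)] at key
  simp only [Finset.sum_const, Finset.card_univ, Fintype.card_fin, nsmul_eq_mul] at key
  change 0 ≤ n * relEntropy q p + Real.log π * sampleProb q S + Real.log 2 * 1 at key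
  linarith

end Samples


/-! ### Marginals and mutual information of distributions on `Fin d → Fin r` -/

section PairMarginals

variable {d r : ℕ}

/-- Law of one coordinate. -/
noncomputable def nodeLaw (p : (Fin d → Fin r) → ℝ) (i : Fin d) (a : Fin r) : ℝ :=
  ∑ x, if x i = a then p x else 0

/-- Joint law of two coordinates. -/
noncomputable def pairLaw (p : (Fin d → Fin r) → ℝ) (i j : Fin d) (a b : Fin r) : ℝ :=
  ∑ x, if x i = a ∧ x j = b then p x else 0

/-- Mutual information of two coordinates. -/
noncomputable def pairInfo (p : (Fin d → Fin r) → ℝ) (i j : Fin d) : ℝ :=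
  mutualInfo (pairLaw p i j)

theorem sum_nodeLaw_mul (p : (Fin d → Fin r) → ℝ) (i : Fin d) (F : Fin r → ℝ) :
    ∑ a, nodeLaw p i a * F a = ∑ x, p x * F (x i) := by
  simp only [nodeLaw, Finset.sum_mul]
  rw [Finset.sum_comm]
  refine Finset.sum_congr rfl fun x _ => ?_
  simp [ite_mul]

theorem sum_pairLaw_mul (p : (Fin d → Fin r) → ℝ) (i j : Fin d) (F : Fin r → Fin r → ℝ) :
    ∑ a, ∑ b, pairLaw p i j a b * F a b = ∑ x, p x * F (x i) (x j) := by
  simp only [pairLaw, Finset.sum_mul]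
  rw [Finset.sum_congr rfl fun a _ => Finset.sum_comm, Finset.sum_comm]
  refine Finset.sum_congr rfl fun x _ => ?_
  simp [ite_mul, ite_and]

theorem sum_pairLaw_right (p : (Fin d → Fin r) → ℝ) (i j : Fin d) (a : Fin r) :
    ∑ b, pairLaw p i j a b = nodeLaw p i a := by
  simp only [pairLaw, nodeLaw]
  rw [Finset.sum_comm]
  refine Finset.sum_congr rfl fun x _ => ?_
  simp [ite_and]

theorem pairLaw_comm (p : (Fin d → Fin r) → ℝ) (i j : Fin d) (a b : Fin r) :
    pairLaw p i j a b = pairLaw p j i b a := by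
  simp only [pairLaw, and_comm]

theorem sum_pairLaw_left (p : (Fin d → Fin r) → ℝ) (i j : Fin d) (b : Fin r) :
    ∑ a, pairLaw p i j a b = nodeLaw p j b := by
  rw [← sum_pairLaw_right p j i b]
  exact Finset.sum_congr rfl fun a _ => pairLaw_comm p i j a b

theorem mutualInfo_comm (Q : Fin r → Fin r → ℝ) : mutualInfo Q = mutualInfo fun a b => Q b a := by
  unfold mutualInfo
  rw [Finset.sum_comm]
  simp only [mul_comm]

theorem pairInfo_comm (p : (Fin d → Fin r) → ℝ) (i j : Fin d) : pairInfo p i j = pairInfo p j i := by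
  unfold pairInfo
  rw [mutualInfo_comm]
  congr 1
  ext a b
  exact pairLaw_comm p i j b a

theorem pairLaw_empirical {n : ℕ} (x : Fin n → Fin d → Fin r) (i j : Fin d) :
    pairLaw (empirical x) i j = pairType x i j := by
  ext a b
  have := sum_empirical_mul x (fun y => if y i = a ∧ y j = b then (1 : ℝ) else 0)
  simp only [mul_ite, mul_one, mul_zero] at this
  unfold pairLaw pairType
  rw [this]
  simp

theorem pairInfo_empirical {n : ℕ} (x : Fin n → Fin d → Fin r) (i j : Fin d) :
    pairInfo (empirical x) i j = empMI x s(i, j) := by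
  unfold pairInfo
  rw [pairLaw_empirical]
  rfl

theorem nodeLaw_nonneg {p : (Fin d → Fin r) → ℝ} (hp : ∀ x, 0 ≤ p x) (i : Fin d) (a : Fin r) :
    0 ≤ nodeLaw p i a :=
  Finset.sum_nonneg fun x _ => by split_ifs <;> simp [hp]

theorem pairLaw_nonneg {p : (Fin d → Fin r) → ℝ} (hp : ∀ x, 0 ≤ p x) (i j : Fin d) (a b : Fin r) :
    0 ≤ pairLaw p i j a b :=
  Finset.sum_nonneg fun x _ => by split_ifs <;> simp [hp]

theorem pairLaw_le_nodeLaw_left {p : (Fin d → Fin r) → ℝ} (hp : ∀ x, 0 ≤ p x) (i j : Fin d)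
    (a b : Fin r) : pairLaw p i j a b ≤ nodeLaw p i a := by
  rw [← sum_pairLaw_right p i j a]
  exact Finset.single_le_sum (fun b _ => pairLaw_nonneg hp i j a b) (Finset.mem_univ b)

theorem pairLaw_le_nodeLaw_right {p : (Fin d → Fin r) → ℝ} (hp : ∀ x, 0 ≤ p x) (i j : Fin d)
    (a b : Fin r) : pairLaw p i j a b ≤ nodeLaw p j b := by
  rw [pairLaw_comm]
  exact pairLaw_le_nodeLaw_left hp j i b a

theorem nodeLaw_mem_stdSimplex {p : (Fin d → Fin r) → ℝ} (hp : p ∈ stdSimplex ℝ (Fin d → Fin r))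
    (i : Fin d) : nodeLaw p i ∈ stdSimplex ℝ (Fin r) := by
  refine ⟨nodeLaw_nonneg hp.1 i, ?_⟩
  have := sum_nodeLaw_mul p i fun _ => 1
  simpa [hp.2] using this

theorem pairLaw_mem_stdSimplex {p : (Fin d → Fin r) → ℝ} (hp : p ∈ stdSimplex ℝ (Fin d → Fin r))
    (i j : Fin d) : (fun z : Fin r × Fin r => pairLaw p i j z.1 z.2) ∈ stdSimplex ℝ _ := by
  refine ⟨fun z => pairLaw_nonneg hp.1 i j _ _, ?_⟩
  have := sum_pairLaw_mul p i j fun _ _ => 1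
  rw [Fintype.sum_prod_type]
  simpa [hp.2] using this

theorem mul_mem_stdSimplex {β γ : Type*} [Fintype β] [Fintype γ] {u : β → ℝ} {v : γ → ℝ}
    (hu : u ∈ stdSimplex ℝ β) (hv : v ∈ stdSimplex ℝ γ) :
    (fun z : β × γ => u z.1 * v z.2) ∈ stdSimplex ℝ (β × γ) := by
  refine ⟨fun z => mul_nonneg (hu.1 _) (hv.1 _), ?_⟩
  rw [Fintype.sum_prod_type]
  simp [← Finset.mul_sum, hu.2, hv.2]

theorem pairInfo_eq_relEntropy (p : (Fin d → Fin r) → ℝ) (i j : Fin d) :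
    pairInfo p i j = relEntropy (fun z : Fin r × Fin r => pairLaw p i j z.1 z.2)
      fun z => nodeLaw p i z.1 * nodeLaw p j z.2 := by
  unfold pairInfo mutualInfo relEntropy
  rw [Fintype.sum_prod_type]
  simp only [sum_pairLaw_right, sum_pairLaw_left]

theorem nodeLaw_mul_pos {p : (Fin d → Fin r) → ℝ} (hp : ∀ x, 0 ≤ p x) {i j : Fin d} {a b : Fin r}
    (h : 0 < pairLaw p i j a b) : 0 < nodeLaw p i a * nodeLaw p j b :=
  mul_pos (h.trans_le (pairLaw_le_nodeLaw_left hp i j a b))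
    (h.trans_le (pairLaw_le_nodeLaw_right hp i j a b))

/-- Pinsker-type lower bound for the mutual information. -/
theorem sq_sub_le_pairInfo {p : (Fin d → Fin r) → ℝ} (hp : p ∈ stdSimplex ℝ (Fin d → Fin r))
    (i j : Fin d) {f g : Fin r → ℝ} (hf : ∀ a, |f a| ≤ 1) (hg : ∀ a, |g a| ≤ 1) :
    (∑ x, p x * (f (x i) * g (x j)) - (∑ x, p x * f (x i)) * ∑ x, p x * g (x j)) ^ 2 / 16
      ≤ pairInfo p i j := by
  rw [pairInfo_eq_relEntropy]
  have := sq_sub_le_relEntropy (pairLaw_mem_stdSimplex hp i j)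
    (mul_mem_stdSimplex (nodeLaw_mem_stdSimplex hp i) (nodeLaw_mem_stdSimplex hp j))
    (fun z hz => nodeLaw_mul_pos hp.1 hz) (φ := fun z => f z.1 * g z.2)
    (fun z => by rw [abs_mul]; exact mul_le_one₀ (hf _) (abs_nonneg _) (hg _))
  rw [Fintype.sum_prod_type, Fintype.sum_prod_type] at this
  have h2 : ∑ a, ∑ b, nodeLaw p i a * nodeLaw p j b * (f a * g b)
      = (∑ x, p x * f (x i)) * ∑ x, p x * g (x j) := by
    rw [← sum_nodeLaw_mul, ← sum_nodeLaw_mul, Finset.sum_mul_sum]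
    exact Finset.sum_congr rfl fun a _ => Finset.sum_congr rfl fun b _ => by ring
  simp only [h2, sum_pairLaw_mul p i j fun a b => f a * g b] at this
  exact this

theorem pairLaw_eq_mul_of_pairInfo_nonpos {p : (Fin d → Fin r) → ℝ}
    (hp : p ∈ stdSimplex ℝ (Fin d → Fin r)) {i j : Fin d} (h : pairInfo p i j ≤ 0) (a b : Fin r) :
    pairLaw p i j a b = nodeLaw p i a * nodeLaw p j b := by
  rw [pairInfo_eq_relEntropy] at h
  exact congrFun (eq_of_relEntropy_nonpos (pairLaw_mem_stdSimplex hp i j)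
    (mul_mem_stdSimplex (nodeLaw_mem_stdSimplex hp i) (nodeLaw_mem_stdSimplex hp j))
    (fun z hz => nodeLaw_mul_pos hp.1 hz) h) (a, b)

/-- Mutual information as a combination of entropies; it has no quotients, so continuity on the
whole simplex follows. -/
theorem pairInfo_eq_negMulLog {p : (Fin d → Fin r) → ℝ} (hp : ∀ x, 0 ≤ p x) (i j : Fin d) :
    pairInfo p i j = (∑ a, Real.negMulLog (nodeLaw p i a)) + (∑ b, Real.negMulLog (nodeLaw p j b))
      - ∑ a, ∑ b, Real.negMulLog (pairLaw p i j a b) := by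
  have h1 : ∑ a, Real.negMulLog (nodeLaw p i a)
      = ∑ a, ∑ b, -(pairLaw p i j a b * Real.log (nodeLaw p i a)) := by
    refine Finset.sum_congr rfl fun a _ => ?_
    rw [Finset.sum_neg_distrib, ← Finset.sum_mul, sum_pairLaw_right, Real.negMulLog]; ring
  have h2 : ∑ b, Real.negMulLog (nodeLaw p j b)
      = ∑ a, ∑ b, -(pairLaw p i j a b * Real.log (nodeLaw p j b)) := by
    rw [Finset.sum_comm]
    refine Finset.sum_congr rfl fun a _ => ?_
    rw [Finset.sum_neg_distrib, ← Finset.sum_mul, sum_pairLaw_left, Real.negMulLog]; ring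
  rw [h1, h2, ← Finset.sum_add_distrib, ← Finset.sum_sub_distrib]
  unfold pairInfo mutualInfo
  refine Finset.sum_congr rfl fun a _ => ?_
  rw [← Finset.sum_add_distrib, ← Finset.sum_sub_distrib]
  refine Finset.sum_congr rfl fun b _ => ?_
  rw [sum_pairLaw_right, sum_pairLaw_left]
  rcases (pairLaw_nonneg hp i j a b).eq_or_lt with h0 | h0
  · simp [← h0]
  · have hm := nodeLaw_mul_pos hp h0
    have hi := h0.trans_le (pairLaw_le_nodeLaw_left hp i j a b)
    have hj := h0.trans_le (pairLaw_le_nodeLaw_right hp i j a b)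
    rw [Real.log_div h0.ne' hm.ne', Real.log_mul hi.ne' hj.ne', Real.negMulLog]
    ring

theorem continuous_nodeLaw (i : Fin d) (a : Fin r) :
    Continuous fun p : (Fin d → Fin r) → ℝ => nodeLaw p i a := by
  unfold nodeLaw
  refine continuous_finsetSum _ fun x _ => ?_
  split_ifs <;> fun_prop

theorem continuous_pairLaw (i j : Fin d) (a b : Fin r) :
    Continuous fun p : (Fin d → Fin r) → ℝ => pairLaw p i j a b := by
  unfold pairLaw
  refine continuous_finsetSum _ fun x _ => ?_
  split_ifs <;> fun_prop

theorem continuousOn_pairInfo (i j : Fin d) :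
    ContinuousOn (fun p : (Fin d → Fin r) → ℝ => pairInfo p i j) (stdSimplex ℝ _) := by
  have : Continuous fun p : (Fin d → Fin r) → ℝ =>
      (∑ a, Real.negMulLog (nodeLaw p i a)) + (∑ b, Real.negMulLog (nodeLaw p j b))
      - ∑ a, ∑ b, Real.negMulLog (pairLaw p i j a b) := by
    have h1 := fun a => Real.continuous_negMulLog.comp (continuous_nodeLaw (d := d) (r := r) i a)
    have h2 := fun a => Real.continuous_negMulLog.comp (continuous_nodeLaw (d := d) (r := r) j a)
    have h3 := fun a b => Real.continuous_negMulLog.comp (continuous_pairLaw (d := d) (r := r) i j a b)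
    exact ((continuous_finsetSum _ fun a _ => h1 a).add (continuous_finsetSum _ fun a _ => h2 a)).sub
      (continuous_finsetSum _ fun a _ => continuous_finsetSum _ fun b _ => h3 a b)
  exact this.continuousOn.congr fun p hp => pairInfo_eq_negMulLog hp.1 i j

/-- Under independence the divergence from `p` dominates the mutual information. -/
theorem pairInfo_le_relEntropy {p q : (Fin d → Fin r) → ℝ} (hp : p ∈ stdSimplex ℝ (Fin d → Fin r))
    (hq : q ∈ stdSimplex ℝ (Fin d → Fin r)) (hqp : ∀ x, 0 < q x → 0 < p x) {i j : Fin d}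
    (hind : ∀ a b, pairLaw p i j a b = nodeLaw p i a * nodeLaw p j b) :
    pairInfo q i j ≤ relEntropy q p := by
  have hle : ∀ x : Fin d → Fin r, q x ≤ pairLaw q i j (x i) (x j) := fun x => by
    unfold pairLaw
    refine le_trans ?_ (Finset.single_le_sum (f := fun y => if y i = x i ∧ y j = x j then q y else 0)
      (fun y _ => by split_ifs <;> simp [hq.1]) (Finset.mem_univ x))
    simp
  have hnode : ∀ x : Fin d → Fin r, ∀ k, p x ≤ nodeLaw p k (x k) := fun x k => by
    unfold nodeLaw
    refine le_trans ?_ (Finset.single_le_sum (f := fun y => if y k = x k then p y else 0)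
      (fun y _ => by split_ifs <;> simp [hp.1]) (Finset.mem_univ x))
    simp
  have hnodeq : ∀ x : Fin d → Fin r, ∀ k, q x ≤ nodeLaw q k (x k) := fun x k => by
    unfold nodeLaw
    refine le_trans ?_ (Finset.single_le_sum (f := fun y => if y k = x k then q y else 0)
      (fun y _ => by split_ifs <;> simp [hq.1]) (Finset.mem_univ x))
    simp
  have hac : ∀ k a, 0 < nodeLaw q k a → 0 < nodeLaw p k a := by
    intro k a h
    obtain ⟨x, -, hx⟩ := Finset.exists_ne_zero_of_sum_ne_zero h.ne'
    by_cases hxa : x k = a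
    · rw [if_pos hxa] at hx
      rw [← hxa]
      exact (hqp x ((hq.1 x).lt_of_ne' hx)).trans_le (hnode x k)
    · simp [hxa] at hx
  have hi := relEntropy_nonneg (nodeLaw_mem_stdSimplex hq i) (nodeLaw_nonneg hp.1 i)
    (nodeLaw_mem_stdSimplex hp i).2.le (hac i)
  have hj := relEntropy_nonneg (nodeLaw_mem_stdSimplex hq j) (nodeLaw_nonneg hp.1 j)
    (nodeLaw_mem_stdSimplex hp j).2.le (hac j)
  -- By independence, multiplying `p` by `F` replaces its `(i, j)`-marginal by that of `q`. The
  -- divergence of `q` from this law is `D(q ‖ p) - I_q(i, j)` minus the two node divergences, all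
  -- three of `D(q ‖ p * F)` and these being nonnegative.
  set F : Fin r → Fin r → ℝ := fun a b => pairLaw q i j a b / (nodeLaw p i a * nodeLaw p j b)
  have hF : ∀ a b, 0 ≤ F a b := fun a b => div_nonneg (pairLaw_nonneg hq.1 i j a b)
    (mul_nonneg (nodeLaw_nonneg hp.1 i a) (nodeLaw_nonneg hp.1 j b))
  have key := relEntropy_nonneg (p := fun x => p x * F (x i) (x j)) hq
    (fun x => mul_nonneg (hp.1 x) (hF _ _)) ?_ ?_
  · have hsplit : relEntropy q (fun x => p x * F (x i) (x j))
        = relEntropy q p - pairInfo q i j - relEntropy (nodeLaw q i) (nodeLaw p i)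
          - relEntropy (nodeLaw q j) (nodeLaw p j) := by
      have e1 : pairInfo q i j = ∑ x, q x * Real.log (pairLaw q i j (x i) (x j)
          / (nodeLaw q i (x i) * nodeLaw q j (x j))) := by
        rw [← sum_pairLaw_mul q i j fun a b => Real.log (pairLaw q i j a b
          / (nodeLaw q i a * nodeLaw q j b))]
        unfold pairInfo mutualInfo
        simp only [sum_pairLaw_right, sum_pairLaw_left]
      have e2 : ∀ k, relEntropy (nodeLaw q k) (nodeLaw p k)
          = ∑ x, q x * Real.log (nodeLaw q k (x k) / nodeLaw p k (x k)) := fun k =>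
        sum_nodeLaw_mul q k fun a => Real.log (nodeLaw q k a / nodeLaw p k a)
      rw [e1, e2, e2]
      unfold relEntropy
      rw [← Finset.sum_sub_distrib, ← Finset.sum_sub_distrib, ← Finset.sum_sub_distrib]
      refine Finset.sum_congr rfl fun x _ => ?_
      rcases (hq.1 x).eq_or_lt with h0 | h0
      · simp [← h0]
      · have a1 := (hqp x h0)
        have a2 := (h0.trans_le (hle x))
        have a3 := a1.trans_le (hnode x i)
        have a4 := a1.trans_le (hnode x j)
        have a5 := h0.trans_le (hnodeq x i)
        have a6 := h0.trans_le (hnodeq x j)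
        simp only [F]
        rw [Real.log_div h0.ne' (by positivity), Real.log_mul a1.ne' (by positivity),
          Real.log_div a2.ne' (by positivity), Real.log_mul a3.ne' a4.ne',
          Real.log_div h0.ne' a1.ne', Real.log_div a2.ne' (by positivity),
          Real.log_mul a5.ne' a6.ne', Real.log_div a5.ne' a3.ne', Real.log_div a6.ne' a4.ne']
        ring
    linarith
  · rw [← sum_pairLaw_mul p i j F, ← (pairLaw_mem_stdSimplex hq i j).2, Fintype.sum_prod_type]
    refine Finset.sum_le_sum fun a _ => Finset.sum_le_sum fun b _ => ?_
    rw [hind]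
    rcases eq_or_ne (nodeLaw p i a * nodeLaw p j b) 0 with h0 | h0
    · rw [h0, zero_mul]
      exact pairLaw_nonneg hq.1 i j a b
    · exact (mul_div_cancel₀ _ h0).le
  · intro x hx
    have a1 := hqp x hx
    have a2 := (hx.trans_le (hle x))
    have a3 := a1.trans_le (hnode x i)
    have a4 := a1.trans_le (hnode x j)
    simp only [F]
    positivity

end PairMarginals

/-! ### Resampling one coordinate independently -/

section Resample

variable {d r : ℕ}

/-- The law obtained from `q` by replacing the coordinate `v` by an independent copy. -/
noncomputable def resample (q : (Fin d → Fin r) → ℝ) (v : Fin d) (x : Fin d → Fin r) : ℝ :=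
  ∑ c, q (Function.update x v c) * nodeLaw q v (x v)

/-- Exchanging the old and the new value of the coordinate `v` is an involution on pairs
(configuration, value), so the expectation can be taken by drawing from `q` first and then redrawing
`v`. -/
theorem sum_resample_mul (q : (Fin d → Fin r) → ℝ) (v : Fin d) (F : (Fin d → Fin r) → ℝ) :
    ∑ x, resample q v x * F x
      = ∑ x, q x * ∑ c, nodeLaw q v c * F (Function.update x v c) := by
  simp only [resample, Finset.sum_mul, Finset.mul_sum]
  rw [← Fintype.sum_prod_type' (f := fun x c => q (Function.update x v c) * nodeLaw q v (x v) * F x),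
    ← Fintype.sum_prod_type' (f := fun x c => q x * (nodeLaw q v c * F (Function.update x v c)))]
  have hinv : Function.Involutive
      fun z : (Fin d → Fin r) × Fin r => (Function.update z.1 v z.2, z.1 v) := by
    rintro ⟨x, c⟩
    simp
  refine Fintype.sum_equiv hinv.toPerm _ _ ?_
  rintro ⟨x, c⟩
  simp [mul_assoc]

theorem resample_mem_stdSimplex {q : (Fin d → Fin r) → ℝ} (hq : q ∈ stdSimplex ℝ (Fin d → Fin r))
    (v : Fin d) : resample q v ∈ stdSimplex ℝ (Fin d → Fin r) := by
  refine ⟨fun x => Finset.sum_nonneg fun c _ => mul_nonneg (hq.1 _) (nodeLaw_nonneg hq.1 _ _), ?_⟩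
  have := sum_resample_mul q v fun _ => 1
  simpa [(nodeLaw_mem_stdSimplex hq v).2, hq.2] using this

theorem pairLaw_eq_sum_mul (q : (Fin d → Fin r) → ℝ) (i j : Fin d) (a b : Fin r) :
    pairLaw q i j a b = ∑ x, q x * if x i = a ∧ x j = b then 1 else 0 := by
  simp [pairLaw]

theorem pairLaw_resample_of_ne {q : (Fin d → Fin r) → ℝ} (hq : q ∈ stdSimplex ℝ (Fin d → Fin r))
    {v i j : Fin d} (hi : i ≠ v) (hj : j ≠ v) : pairLaw (resample q v) i j = pairLaw q i j := by
  ext a b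
  rw [pairLaw_eq_sum_mul, sum_resample_mul]
  simp [Function.update_of_ne hi, Function.update_of_ne hj, (nodeLaw_mem_stdSimplex hq v).2,
    pairLaw]

theorem pairLaw_resample {q : (Fin d → Fin r) → ℝ}
    {u v : Fin d} (hu : u ≠ v) (a b : Fin r) :
    pairLaw (resample q v) u v a b = nodeLaw q u a * nodeLaw q v b := by
  rw [pairLaw_eq_sum_mul, sum_resample_mul]
  simp only [Function.update_of_ne hu, Function.update_self, mul_ite, mul_one, mul_zero, ite_and]
  rw [← sum_nodeLaw_mul q u fun c => ∑ x, if c = a then if x = b then nodeLaw q v x else 0 else 0]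
  simp

theorem pairLaw_mix (q q' : (Fin d → Fin r) → ℝ) (t : ℝ) (i j : Fin d) (a b : Fin r) :
    pairLaw ((1 - t) • q + t • q') i j a b
      = (1 - t) * pairLaw q i j a b + t * pairLaw q' i j a b := by
  unfold pairLaw
  rw [Finset.mul_sum, Finset.mul_sum, ← Finset.sum_add_distrib]
  refine Finset.sum_congr rfl fun x _ => ?_
  split_ifs <;> simp

theorem pairInfo_mix_resample_of_ne {q : (Fin d → Fin r) → ℝ}
    (hq : q ∈ stdSimplex ℝ (Fin d → Fin r)) {v i j : Fin d} (hi : i ≠ v) (hj : j ≠ v) (t : ℝ) :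
    pairInfo ((1 - t) • q + t • resample q v) i j = pairInfo q i j := by
  unfold pairInfo
  congr 1
  ext a b
  rw [pairLaw_mix, pairLaw_resample_of_ne hq hi hj]
  ring

/-- The mixture moves the law of `(u, v)` towards the product of its marginals without changing
them. With `ρ` this product, each term is `ρ * ψ(s / ρ)` for the convex `ψ(y) = y log y`, and `ψ(1)
= 0`. -/
theorem pairInfo_mix_resample_le {q : (Fin d → Fin r) → ℝ}
    (hq : q ∈ stdSimplex ℝ (Fin d → Fin r)) {u v : Fin d} (hu : u ≠ v) {t : ℝ} (h0 : 0 ≤ t)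
    (h1 : t ≤ 1) :
    pairInfo ((1 - t) • q + t • resample q v) u v ≤ (1 - t) * pairInfo q u v := by
  have hlaw : ∀ a b, pairLaw ((1 - t) • q + t • resample q v) u v a b
      = (1 - t) * pairLaw q u v a b + t * (nodeLaw q u a * nodeLaw q v b) := fun a b => by
    rw [pairLaw_mix, pairLaw_resample hu]
  have hn1 : ∀ a, nodeLaw ((1 - t) • q + t • resample q v) u a = nodeLaw q u a := fun a => by
    rw [← sum_pairLaw_right _ u v]
    simp only [hlaw]
    rw [Finset.sum_add_distrib, ← Finset.mul_sum, sum_pairLaw_right, ← Finset.mul_sum,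
      ← Finset.mul_sum, (nodeLaw_mem_stdSimplex hq v).2]
    ring
  have hn2 : ∀ b, nodeLaw ((1 - t) • q + t • resample q v) v b = nodeLaw q v b := fun a => by
    rw [← sum_pairLaw_left _ u v]
    simp only [hlaw]
    rw [Finset.sum_add_distrib, ← Finset.mul_sum, sum_pairLaw_left, ← Finset.mul_sum,
      ← Finset.sum_mul, (nodeLaw_mem_stdSimplex hq u).2]
    ring
  rw [pairInfo_eq_relEntropy, pairInfo_eq_relEntropy]
  unfold relEntropy
  rw [Finset.mul_sum]
  refine Finset.sum_le_sum fun z _ => ?_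
  simp only [hlaw, hn1, hn2]
  set ρ := nodeLaw q u z.1 * nodeLaw q v z.2 with hρ
  set s := pairLaw q u v z.1 z.2 with hs
  have hs0 : 0 ≤ s := pairLaw_nonneg hq.1 _ _ _ _
  rcases (mul_nonneg (nodeLaw_nonneg hq.1 u z.1) (nodeLaw_nonneg hq.1 v z.2)).eq_or_lt with h | h
  · rw [← hρ] at h
    rw [← h]
    simp
  · rw [← hρ] at h
    have hconv := Real.convexOn_mul_log.2 (x := s / ρ) (y := 1) (div_nonneg hs0 h.le)
      (by simp) (sub_nonneg.2 h1) h0 (by ring)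
    simp only [smul_eq_mul, mul_one, Real.log_one, mul_zero, add_zero] at hconv
    have e1 : ((1 - t) * s + t * ρ) / ρ = (1 - t) * (s / ρ) + t := by field_simp
    have hmul := mul_le_mul_of_nonneg_left hconv h.le
    rw [e1]
    have e2 : ((1 - t) * s + t * ρ) * Real.log ((1 - t) * (s / ρ) + t)
        = ρ * (((1 - t) * (s / ρ) + t) * Real.log ((1 - t) * (s / ρ) + t)) := by
      field_simp
    have e3 : (1 - t) * (s * Real.log (s / ρ)) = ρ * ((1 - t) * (s / ρ * Real.log (s / ρ))) := by
      field_simp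
    rw [e2, e3]
    exact hmul

end Resample


/-! ### Maximum-weight spanning trees and thresholding -/

section Trees

variable {d : ℕ}

open Classical in
theorem edgeFinset_exchange {T : SimpleGraph (Fin d)} {f : Sym2 (Fin d)} {i j : Fin d}
    (h : ¬(T.deleteEdges {f}).Reachable i j) :
    (T.deleteEdges {f} ⊔ SimpleGraph.edge i j).edgeFinset
      = insert s(i, j) (T.edgeFinset.erase f) := by
  have hij : i ≠ j := by rintro rfl; exact h (SimpleGraph.Reachable.refl _)
  ext e
  rw [SimpleGraph.mem_edgeFinset, SimpleGraph.edgeSet_sup, SimpleGraph.edgeSet_edge_of_ne hij,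
    SimpleGraph.edgeSet_deleteEdges]
  simp only [Set.mem_union, Set.mem_sdiff, Set.mem_singleton_iff, Finset.mem_insert,
    Finset.mem_erase, SimpleGraph.mem_edgeFinset]
  tauto

open Classical in
theorem notMem_erase_of_not_reachable {T : SimpleGraph (Fin d)} {f : Sym2 (Fin d)} {i j : Fin d}
    (h : ¬(T.deleteEdges {f}).Reachable i j) : s(i, j) ∉ T.edgeFinset.erase f := by
  intro hmem
  rw [Finset.mem_erase, SimpleGraph.mem_edgeFinset] at hmem
  refine h (SimpleGraph.Adj.reachable ?_)
  rw [SimpleGraph.deleteEdges_adj]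
  exact ⟨hmem.2, hmem.1⟩

/-- Exchanging an edge of a spanning tree for one that reconnects it gives a spanning tree. -/
theorem isTree_exchange {T : SimpleGraph (Fin d)} (hT : T.IsTree) {f : Sym2 (Fin d)}
    (hf : f ∈ T.edgeSet) {i j : Fin d} (h : ¬(T.deleteEdges {f}).Reachable i j) :
    (T.deleteEdges {f} ⊔ SimpleGraph.edge i j).IsTree := by
  classical
  have : Nonempty (Fin d) := hT.connected.nonempty
  have hacyc : (T.deleteEdges {f} ⊔ SimpleGraph.edge i j).IsAcyclic :=
    (hT.isAcyclic.anti (SimpleGraph.deleteEdges_le _)).sup_edge_of_not_reachable h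
  -- The exchanged graph is a forest; a spanning tree containing it has the same number of edges and
  -- so equals it.
  obtain ⟨F, hle, -, hF⟩ :=
    (SimpleGraph.connected_top (V := Fin d)).exists_isTree_le_of_le_of_isAcyclic le_top hacyc
  have hcard : (T.deleteEdges {f} ⊔ SimpleGraph.edge i j).edgeFinset.card = F.edgeFinset.card := by
    have h1 := hT.card_edgeFinset
    have h2 := hF.card_edgeFinset
    rw [edgeFinset_exchange h, Finset.card_insert_of_notMem (notMem_erase_of_not_reachable h),
      Finset.card_erase_of_mem (SimpleGraph.mem_edgeFinset.2 hf)]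
    have h3 : 0 < T.edgeFinset.card := Finset.card_pos.2 ⟨f, SimpleGraph.mem_edgeFinset.2 hf⟩
    omega
  have heq := Finset.eq_of_subset_of_card_le (SimpleGraph.edgeFinset_mono hle) hcard.ge
  rw [SimpleGraph.edgeFinset_inj.1 heq]
  exact hF

/-- Cut optimality of a maximum-weight spanning tree. -/
theorem IsMaxSpanningTree.le_of_not_reachable {w : Sym2 (Fin d) → ℝ} {T : SimpleGraph (Fin d)}
    (hT : IsMaxSpanningTree w T) {f : Sym2 (Fin d)} (hf : f ∈ T.edgeSet) {i j : Fin d}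
    (h : ¬(T.deleteEdges {f}).Reachable i j) : w s(i, j) ≤ w f := by
  classical
  have := hT.2 _ (isTree_exchange hT.1 hf h)
  have hw : graphWeight w (T.deleteEdges {f} ⊔ SimpleGraph.edge i j)
      = w s(i, j) + ∑ e ∈ T.edgeFinset.erase f, w e := by
    rw [← Finset.sum_insert (notMem_erase_of_not_reachable h), ← edgeFinset_exchange h]
    unfold graphWeight
    refine Finset.sum_congr ?_ fun _ _ => rfl
    ext; simp
  have hw' : graphWeight w T = w f + ∑ e ∈ T.edgeFinset.erase f, w e := by
    rw [Finset.add_sum_erase _ _ (SimpleGraph.mem_edgeFinset.2 hf)]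
    unfold graphWeight
    refine Finset.sum_congr ?_ fun _ _ => rfl
    ext; simp
  linarith

/-- An edge on a path of a forest separates its ends. -/
theorem not_reachable_deleteEdges_of_mem_edges {T : SimpleGraph (Fin d)} (hT : T.IsAcyclic)
    {u v : Fin d} (p : T.Path u v) {f : Sym2 (Fin d)} (hf : f ∈ p.1.edges) :
    ¬(T.deleteEdges {f}).Reachable u v := by
  intro hr
  obtain ⟨q, hq⟩ := hr.exists_isPath
  have hle : T.deleteEdges {f} ≤ T := SimpleGraph.deleteEdges_le _
  have heq := (hT.subsingleton_path u v).elim p ⟨q.mapLe hle, hq.mapLe hle⟩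
  rw [heq] at hf
  simp only [SimpleGraph.Walk.edges_mapLe_eq_edges] at hf
  have := q.edges_subset_edgeSet hf
  rw [SimpleGraph.edgeSet_deleteEdges] at this
  exact this.2 rfl

/-- A path of a spanning tree leaving `S` has an edge leaving `S` that separates its ends. -/
theorem exists_adj_not_reachable {T : SimpleGraph (Fin d)} (hT : T.IsTree) {u v : Fin d}
    {S : Set (Fin d)} (hu : u ∈ S) (hv : v ∉ S) :
    ∃ i j, T.Adj i j ∧ i ∈ S ∧ j ∉ S ∧ ¬(T.deleteEdges {s(i, j)}).Reachable u v := by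
  classical
  obtain ⟨p, hp⟩ := hT.connected.exists_isPath u v
  obtain ⟨e, he, h1, h2⟩ := p.exists_boundary_dart S hu hv
  exact ⟨e.fst, e.snd, e.adj, h1, h2, not_reachable_deleteEdges_of_mem_edges hT.isAcyclic ⟨p, hp⟩
    (List.mem_map.2 ⟨e, he, rfl⟩)⟩

/-- The vertices that stay connected to `u` after removing the edge `u v`. -/
def side (G : SimpleGraph (Fin d)) (u v : Fin d) : Set (Fin d) :=
  {i | (G.deleteEdges {s(u, v)}).Reachable u i}

theorem mem_side_self (G : SimpleGraph (Fin d)) (u v : Fin d) : u ∈ side G u v :=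
  SimpleGraph.Reachable.refl _

theorem notMem_side {G : SimpleGraph (Fin d)} (hG : G.IsAcyclic) {u v : Fin d} (h : G.Adj u v) :
    v ∉ side G u v :=
  (SimpleGraph.isAcyclic_iff_forall_adj_isBridge.1 hG h : G.IsBridge s(u, v))

/-- Any other edge survives the deletion of `u v` and cannot leave the component. Hence a single
vertex is the Markov boundary of each side. -/
theorem eq_of_adj_side {G : SimpleGraph (Fin d)} (hG : G.IsAcyclic) {u v : Fin d} (h : G.Adj u v)
    {i j : Fin d} (hi : i ∈ side G u v) (hj : j ∉ side G u v) (hij : G.Adj i j) :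
    i = u ∧ j = v := by
  by_cases he : s(i, j) = s(u, v)
  · rcases Sym2.eq_iff.1 he with h1 | h1
    · exact h1
    · exact absurd (h1.1 ▸ hi) (notMem_side hG h)
  · exact absurd (hi.trans (SimpleGraph.Adj.reachable
      (SimpleGraph.deleteEdges_adj.2 ⟨hij, he⟩))) hj

variable {n r : ℕ} {x : Fin n → Fin d → Fin r} {ε : ℝ} {F : SimpleGraph (Fin d)}

/-- The output consists of the edges above the threshold of a maximum-weight spanning tree. -/
theorem IsOutput.exists_tree (h : IsOutput x ε F) :
    ∃ T, IsMaxSpanningTree (empMI x) T ∧ F ≤ T ∧ (∀ e ∈ F.edgeSet, ε ≤ empMI x e) ∧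
      ∀ e ∈ T.edgeSet, e ∉ F.edgeSet → empMI x e ≤ ε := by
  obtain ⟨T, hT, e, -, hrange, hanti, k, hk, h1, h2, hF⟩ := h
  refine ⟨T, hT, ?_, ?_, ?_⟩
  · rw [← SimpleGraph.edgeSet_subset_edgeSet, hF, ← hrange]
    rintro _ ⟨j, -, rfl⟩
    exact ⟨j, rfl⟩
  · rw [hF]
    rintro _ ⟨j, hj, rfl⟩
    -- The last edge kept has index `k - 1`; it exists because `j < k` forces `k ≥ 1`.
    have hlt : k - 1 < d - 1 := by omega
    refine (h1 ⟨k - 1, hlt⟩ (by simp only; omega)).trans (hanti ?_)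
    rw [Fin.le_def]
    simp only
    omega
  · rw [hF, ← hrange]
    rintro _ ⟨j, rfl⟩ hj
    have hkj : k ≤ j := by
      by_contra hlt
      exact hj ⟨j, not_le.1 hlt, rfl⟩
    have hlt : k < d - 1 := hkj.trans_lt j.2
    exact (hanti (a := ⟨k, hlt⟩) (Fin.le_def.2 hkj)).trans (h2 ⟨k, hlt⟩ rfl)

variable {G : SimpleGraph (Fin d)}

/-- Conditions on the empirical weights under which the algorithm makes no error. -/
theorem IsOutput.eq_of_forall (h : IsOutput x ε F) (hG : G.IsAcyclic)
    (hcross : ∀ u v, G.Adj u v → ∀ i ∈ side G u v, ∀ j ∉ side G u v, s(i, j) ≠ s(u, v) →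
      empMI x s(i, j) < empMI x s(u, v))
    (hedge : ∀ u v, G.Adj u v → ε < empMI x s(u, v))
    (hfar : ∀ i j, ¬G.Reachable i j → empMI x s(i, j) < ε) : F = G := by
  obtain ⟨T, hT, hFT, h1, h2⟩ := h.exists_tree
  -- If an edge `u v` of `G` were missing from `T`, the path of `T` from `u` to `v` would cross the
  -- cut at a pair of strictly smaller weight, and exchanging would improve `T`.
  have hGT : G ≤ T := by
    intro u v huv
    by_contra hcon
    obtain ⟨i, j, hij, hi, hj, hsep⟩ :=
      exists_adj_not_reachable hT.1 (mem_side_self G u v) (notMem_side hG huv)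
    have hle := hT.le_of_not_reachable ((SimpleGraph.mem_edgeSet _).2 hij) hsep
    have hne : s(i, j) ≠ s(u, v) := by
      intro heq
      rw [← SimpleGraph.mem_edgeSet, ← heq] at hcon
      exact hcon hij
    exact absurd (hcross u v huv i hi j hj hne) (not_lt.2 hle)
  -- Since `G ≤ T`, an edge of `T` outside `G` joins different components of `G`: otherwise it would
  -- close a cycle in `T`.
  have hnew : ∀ i j, T.Adj i j → ¬G.Adj i j → empMI x s(i, j) < ε := by
    intro i j hij hnij
    refine hfar i j fun hr => ?_
    have hb : T.IsBridge s(i, j) :=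
      SimpleGraph.isAcyclic_iff_forall_adj_isBridge.1 hT.1.isAcyclic hij
    refine hb (hr.mono fun a b hab => SimpleGraph.deleteEdges_adj.2 ⟨hGT hab, fun heq => hnij ?_⟩)
    rw [← SimpleGraph.mem_edgeSet, ← Set.mem_singleton_iff.1 heq]
    exact hab
  refine le_antisymm (fun i j hij => ?_) fun i j hij => ?_
  · by_contra hcon
    exact absurd (hnew i j (hFT hij) hcon) (not_lt.2 (h1 s(i, j) hij))
  · by_contra hcon
    exact absurd (hedge i j hij) (not_lt.2 (h2 s(i, j) (hGT hij) hcon))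

theorem IsOutput.le_of_adj (h : IsOutput x ε G) {u v : Fin d} (huv : G.Adj u v) :
    ε ≤ empMI x s(u, v) := by
  obtain ⟨T, -, -, h1, -⟩ := h.exists_tree
  exact h1 _ huv

/-- The path of `T` from `i` to `j` leaves the component of `i` in `G` through a discarded edge,
which weighs at most `ε` and, by cut optimality, at least as much as the pair `i, j`. -/
theorem IsOutput.le_of_not_reachable (h : IsOutput x ε G) {i j : Fin d} (hij : ¬G.Reachable i j) :
    empMI x s(i, j) ≤ ε := by
  obtain ⟨T, hT, -, -, h2⟩ := h.exists_tree
  obtain ⟨a, b, hab, ha, hb, hsep⟩ := exists_adj_not_reachable (S := {k | G.Reachable i k}) hT.1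
    (SimpleGraph.Reachable.refl i) hij
  refine (hT.le_of_not_reachable ((SimpleGraph.mem_edgeSet _).2 hab) hsep).trans (h2 _ hab fun he => ?_)
  exact hb (SimpleGraph.Reachable.trans ha (SimpleGraph.Adj.reachable he))

/-- A spanning tree output is all of `T`, so cut optimality applies to the edges of `G`. -/
theorem IsOutput.le_of_side (h : IsOutput x ε G) (hG : G.IsTree) {u v i j : Fin d}
    (huv : G.Adj u v) (hi : i ∈ side G u v) (hj : j ∉ side G u v) :
    empMI x s(i, j) ≤ empMI x s(u, v) := by
  obtain ⟨T, hT, hGT, -, -⟩ := h.exists_tree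
  have heq : G = T :=
    le_antisymm hGT ((SimpleGraph.isTree_iff_minimal_connected.1 hT.1).2 hG.connected hGT)
  subst heq
  exact hT.le_of_not_reachable ((SimpleGraph.mem_edgeSet _).2 huv) fun hr => hj (hi.trans hr)

end Trees

/-- In a nonempty set of vertices of a forest some vertex has at most one neighbour in the set. -/
theorem exists_leaf {d : ℕ} {G : SimpleGraph (Fin d)} (hG : G.IsAcyclic) {A : Finset (Fin d)}
    (hA : A.Nonempty) : ∃ l ∈ A, ∀ i ∈ A, ∀ j ∈ A, G.Adj l i → G.Adj l j → i = j := by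
  classical
  obtain ⟨l, rfl⟩ | hnt := hA.exists_eq_singleton_or_nontrivial
  · refine ⟨l, by simp, fun i hi j hj _ _ => ?_⟩
    rw [Finset.mem_singleton.1 hi, Finset.mem_singleton.1 hj]
  · have : Nontrivial (A : Set (Fin d)) := Set.nontrivial_coe_sort.2 hnt
    -- A leaf of a spanning tree containing the induced forest has at most one neighbour in the
    -- forest.
    obtain ⟨F, hle, -, hF⟩ :=
      (SimpleGraph.connected_top (V := (A : Set (Fin d)))).exists_isTree_le_of_le_of_isAcyclic
        le_top (hG.induce (A : Set (Fin d)))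
    obtain ⟨l, hl⟩ := hF.exists_vert_degree_one_of_nontrivial
    obtain ⟨k, -, hk⟩ := SimpleGraph.degree_eq_one_iff_existsUnique_adj.1 hl
    refine ⟨l, l.2, fun i hi j hj h1 h2 => ?_⟩
    have e1 := hk ⟨i, hi⟩ (hle h1)
    have e2 := hk ⟨j, hj⟩ (hle h2)
    exact congrArg Subtype.val (e1.trans e2.symm)


/-! ### Markov properties of distributions on forests -/

section Marginals

variable {d r : ℕ}

open Classical in
/-- Marginal of `p` on the coordinates in `A`, as a function of the whole configuration. -/
noncomputable def marg (p : (Fin d → Fin r) → ℝ) (A : Set (Fin d)) (x : Fin d → Fin r) : ℝ :=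
  ∑ y, if ∀ j ∈ A, y j = x j then p y else 0

open Classical in
/-- Sum of `f` over the coordinates in `S`. -/
noncomputable def sumOut (S : Set (Fin d)) (f : (Fin d → Fin r) → ℝ) (x : Fin d → Fin r) : ℝ :=
  ∑ z, if ∀ j ∉ S, z j = x j then f z else 0

variable {p : (Fin d → Fin r) → ℝ}

theorem marg_congr {A : Set (Fin d)} {x y : Fin d → Fin r} (h : ∀ j ∈ A, x j = y j) :
    marg p A x = marg p A y := by
  classical
  refine Finset.sum_congr rfl fun z _ => ?_
  have : (∀ j ∈ A, z j = x j) ↔ ∀ j ∈ A, z j = y j :=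
    ⟨fun hz j hj => (hz j hj).trans (h j hj), fun hz j hj => (hz j hj).trans (h j hj).symm⟩
  simp only [this]

theorem marg_mono (hp : ∀ x, 0 ≤ p x) {A B : Set (Fin d)} (h : A ⊆ B) (x : Fin d → Fin r) :
    marg p B x ≤ marg p A x := by
  classical
  refine Finset.sum_le_sum fun y _ => ?_
  by_cases hB : ∀ j ∈ B, y j = x j
  · rw [if_pos hB, if_pos fun j hj => hB j (h hj)]
  · rw [if_neg hB]
    split_ifs <;> simp [hp]

theorem marg_nonneg (hp : ∀ x, 0 ≤ p x) (A : Set (Fin d)) (x : Fin d → Fin r) : 0 ≤ marg p A x :=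
  Finset.sum_nonneg fun y _ => by split_ifs <;> simp [hp]

theorem marg_univ (x : Fin d → Fin r) : marg p Set.univ x = p x := by
  classical
  simp [marg, ← funext_iff]

theorem marg_pos (hp : ∀ x, 0 < p x) (A : Set (Fin d)) (x : Fin d → Fin r) : 0 < marg p A x :=
  (hp x).trans_le ((marg_univ (p := p) x).symm.trans_le
    (marg_mono (fun y => (hp y).le) (Set.subset_univ A) x))

theorem marg_empty (hp : ∑ x, p x = 1) (x : Fin d → Fin r) : marg p ∅ x = 1 := by
  simp [marg, hp]

theorem marg_singleton (i : Fin d) (x : Fin d → Fin r) : marg p {i} x = nodeLaw p i (x i) := by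
  simp [marg, nodeLaw]

theorem marg_pair (i j : Fin d) (x : Fin d → Fin r) :
    marg p {i, j} x = pairLaw p i j (x i) (x j) := by
  simp [marg, pairLaw]

theorem sumOut_mul {S : Set (Fin d)} {f g : (Fin d → Fin r) → ℝ} {x : Fin d → Fin r}
    (hg : ∀ z, (∀ j ∉ S, z j = x j) → g z = g x) :
    sumOut S (fun z => f z * g z) x = sumOut S f x * g x := by
  classical
  unfold sumOut
  rw [Finset.sum_mul]
  refine Finset.sum_congr rfl fun z _ => ?_
  split_ifs with h
  · change f z * g z = f z * g x
    rw [hg z h]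
  · simp

theorem sumOut_marg {S A : Set (Fin d)} (h : S ⊆ A) (x : Fin d → Fin r) :
    sumOut S (marg p A) x = marg p (A \ S) x := by
  classical
  unfold sumOut marg
  have h1 : ∀ z : Fin d → Fin r, (if ∀ j ∉ S, z j = x j then
      (∑ y, if ∀ j ∈ A, y j = z j then p y else 0) else 0)
      = ∑ y, if (∀ j ∉ S, z j = x j) ∧ ∀ j ∈ A, y j = z j then p y else 0 := by
    intro z
    by_cases hz : ∀ j ∉ S, z j = x j
    · rw [if_pos hz]
      exact Finset.sum_congr rfl fun y _ => if_congr ⟨fun h => ⟨hz, h⟩, And.right⟩ rfl rfl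
    · rw [if_neg hz]
      exact (Finset.sum_eq_zero fun y _ => if_neg fun h => hz h.1).symm
  simp only [h1]
  rw [Finset.sum_comm]
  refine Finset.sum_congr rfl fun y _ => ?_
  split_ifs with hy
  -- For fixed `y` the only contributing `z` is `y` on `S` and `x` off `S`.
  · rw [Finset.sum_eq_single (S.piecewise y x)]
    · rw [if_pos]
      refine ⟨fun j hj => Set.piecewise_eq_of_notMem _ _ _ hj, fun j hj => ?_⟩
      by_cases hS : j ∈ S
      · rw [Set.piecewise_eq_of_mem _ _ _ hS]
      · rw [Set.piecewise_eq_of_notMem _ _ _ hS]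
        exact hy j ⟨hj, hS⟩
    · intro z _ hz
      rw [if_neg]
      rintro ⟨h2, h3⟩
      refine hz (funext fun j => ?_)
      by_cases hS : j ∈ S
      · rw [Set.piecewise_eq_of_mem _ _ _ hS]
        exact (h3 j (h hS)).symm
      · rw [Set.piecewise_eq_of_notMem _ _ _ hS]
        exact h2 j hS
    · simp
  · refine Finset.sum_eq_zero fun z _ => if_neg ?_
    rintro ⟨h2, h3⟩
    exact hy fun j hj => (h3 j hj.1).trans (h2 j hj.2)

/-- Summing an identity between products of marginals over coordinates on which the second
factors do not depend. -/
theorem marg_mul_sdiff {S A B A' B' : Set (Fin d)}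
    (h : ∀ x, marg p A x * marg p B x = marg p A' x * marg p B' x)
    (hA : S ⊆ A) (hA' : S ⊆ A') (hB : Disjoint S B) (hB' : Disjoint S B') (x : Fin d → Fin r) :
    marg p (A \ S) x * marg p B x = marg p (A' \ S) x * marg p B' x := by
  have hc : ∀ {C : Set (Fin d)}, Disjoint S C → ∀ z : Fin d → Fin r, (∀ j ∉ S, z j = x j) →
      marg p C z = marg p C x := fun hC z hz =>
    marg_congr fun j hj => hz j fun hS => Set.disjoint_left.1 hC hS hj
  rw [← sumOut_marg hA, ← sumOut_marg hA', ← sumOut_mul (hc hB), ← sumOut_mul (hc hB')]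
  simp only [h]

end Marginals

/-! ### Local Markov property, positivity and the global Markov property -/

section Markov

variable {d r : ℕ}

/-- Local Markov property of the marginal on `A`, in product form. -/
def MarkovIn (p : (Fin d → Fin r) → ℝ) (G : SimpleGraph (Fin d)) (A : Set (Fin d)) : Prop :=
  ∀ i ∈ A, ∀ x, marg p A x * marg p (G.neighborSet i ∩ A) x
    = marg p (A \ {i}) x * marg p (insert i (G.neighborSet i ∩ A)) x

variable {p : (Fin d → Fin r) → ℝ} {G : SimpleGraph (Fin d)}

/-- The local Markov property is inherited when a leaf is removed. -/
theorem MarkovIn.sdiff_leaf {A : Set (Fin d)} (hM : MarkovIn p G A)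
    (hedge : ∀ i j, G.Adj i j → ∀ x, 0 < marg p {i, j} x) {l : Fin d} (hl : l ∈ A)
    (hleaf : ∀ i ∈ A, ∀ j ∈ A, G.Adj l i → G.Adj l j → i = j) : MarkovIn p G (A \ {l}) := by
  rintro i ⟨hi, hil⟩ x
  have hil' : i ≠ l := hil
  by_cases hadj : G.Adj i l
  · have hNl : G.neighborSet l ∩ A = {i} := by
      ext k
      simp only [Set.mem_inter_iff, SimpleGraph.mem_neighborSet, Set.mem_singleton_iff]
      exact ⟨fun h => hleaf k h.2 i hi h.1 hadj.symm, fun h => h ▸ ⟨hadj.symm, hi⟩⟩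
    set N := G.neighborSet i ∩ (A \ {l}) with hN
    have hNi : G.neighborSet i ∩ A = insert l N := by
      ext k
      simp only [hN, Set.mem_inter_iff, SimpleGraph.mem_neighborSet, Set.mem_sdiff,
        Set.mem_singleton_iff, Set.mem_insert_iff]
      constructor
      · intro h
        by_cases hk : k = l
        · exact Or.inl hk
        · exact Or.inr ⟨h.1, h.2, hk⟩
      · rintro (rfl | h)
        · exact ⟨hadj, hl⟩
        · exact ⟨h.1, h.2.1⟩
    have hlN : l ∉ N := fun h => h.2.2 rfl
    have hiN : i ∉ N := fun h => G.irrefl h.1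
    have h1 : ∀ x, marg p A x * marg p {i} x = marg p (A \ {l}) x * marg p {l, i} x := fun x => by
      have := hM l hl x
      rwa [hNl] at this
    have hBA : insert i N ⊆ A \ {l} := by
      rintro k (rfl | hk)
      · exact ⟨hi, hil'⟩
      · exact hk.2
    have h2 : ∀ x, marg p (insert l (insert i N)) x * marg p {i} x
        = marg p (insert i N) x * marg p {l, i} x := fun x => by
      have hS : (A \ {l}) \ insert i N ⊆ A := fun k hk => hk.1.1
      have := marg_mul_sdiff h1 hS Set.sdiff_subset
        (Set.disjoint_left.2 fun k hk hki => hk.2 (Or.inl hki))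
        (Set.disjoint_left.2 fun k hk hki => hki.elim (fun h => hk.1.2 h)
          fun h => hk.2 (Or.inl h)) x
      have e1 : A \ ((A \ {l}) \ insert i N) = insert l (insert i N) := by
        ext k
        by_cases hkl : k = l
        · subst hkl; simp [hl]
        · have := @hBA k
          simp only [Set.mem_sdiff, Set.mem_singleton_iff, Set.mem_insert_iff] at this ⊢
          tauto
      have e2 : (A \ {l}) \ ((A \ {l}) \ insert i N) = insert i N := by
        rw [Set.sdiff_sdiff_right_self, Set.inter_eq_right.2 hBA]
      rwa [e1, e2] at this
    -- Combining the Markov property at `i`, the one at `l`, and the latter's marginal `h2`, the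
    -- common factor `marg p {l, i}` cancels. Only positivity on edges is available here. In `h3`
    -- the coordinate `l` occurs in one factor per side and can be summed out.
    have h3 : ∀ x, marg p (insert l N) x * marg p (A \ {l}) x
        = marg p (A \ {i}) x * marg p (insert i N) x := fun x => by
      have h4 := hM i hi x
      rw [hNi, Set.insert_comm] at h4
      have h5 := h1 x
      have h6 := h2 x
      have h7 := hedge l i hadj.symm x
      refine mul_right_cancel₀ h7.ne' ?_
      linear_combination marg p {i} x * h4 - marg p (insert l N) x * h5
        + marg p (A \ {i}) x * h6
    have := marg_mul_sdiff h3 (S := {l}) (by simp) (by simp [hl, hil'.symm])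
      (by simp) (by simp [hlN, hil'.symm]) x
    have e1 : insert l N \ {l} = N := by simp [hlN]
    have e2 : (A \ {i}) \ {l} = (A \ {l}) \ {i} := by
      rw [Set.sdiff_sdiff, Set.sdiff_sdiff, Set.union_comm]
    rw [e1, e2] at this
    linarith
  · have hNi : G.neighborSet i ∩ (A \ {l}) = G.neighborSet i ∩ A := by
      ext k
      simp only [Set.mem_inter_iff, SimpleGraph.mem_neighborSet, Set.mem_sdiff,
        Set.mem_singleton_iff]
      exact ⟨fun h => ⟨h.1, h.2.1⟩, fun h => ⟨h.1, h.2, fun hk => hadj (hk ▸ h.1)⟩⟩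
    rw [hNi]
    have := marg_mul_sdiff (hM i hi) (S := {l}) (by simpa using hl) (by simp [hl, hil'.symm])
      (by simp [hadj]) (by simp [hadj, hil'.symm]) x
    have e2 : (A \ {i}) \ {l} = (A \ {l}) \ {i} := by
      rw [Set.sdiff_sdiff, Set.sdiff_sdiff, Set.union_comm]
    rwa [e2] at this

/-- On a forest the local Markov property and positivity on nodes and edges give positivity. -/
theorem MarkovIn.marg_pos (hG : G.IsAcyclic) (hp : ∑ x, p x = 1) (hp0 : ∀ x, 0 ≤ p x)
    (hnode : ∀ i x, 0 < marg p {i} x) (hedge : ∀ i j, G.Adj i j → ∀ x, 0 < marg p {i, j} x)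
    (A : Finset (Fin d)) (hM : MarkovIn p G A) (x : Fin d → Fin r) : 0 < marg p A x := by
  classical
  induction A using Finset.strongInduction with
  | H A ih =>
    rcases A.eq_empty_or_nonempty with rfl | hA
    · rw [Finset.coe_empty, marg_empty hp]
      exact one_pos
    · obtain ⟨l, hl, hleaf⟩ := exists_leaf hG hA
      have hM' := hM.sdiff_leaf hedge (Finset.mem_coe.2 hl) hleaf
      have hpos := ih (A.erase l) (Finset.erase_ssubset hl) (by rwa [Finset.coe_erase])
      rw [Finset.coe_erase] at hpos
      -- The Markov property at the leaf has on its right side the smaller marginal, positive by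
      -- induction, times a node or edge marginal.
      have h1 := hM l hl x
      have hpos2 : 0 < marg p (insert l (G.neighborSet l ∩ A)) x := by
        by_cases hex : ∃ k ∈ A, G.Adj l k
        · obtain ⟨k, hk, hlk⟩ := hex
          have : G.neighborSet l ∩ A = {k} := by
            ext m
            simp only [Set.mem_inter_iff, SimpleGraph.mem_neighborSet, Set.mem_singleton_iff,
              Finset.mem_coe]
            exact ⟨fun h => hleaf m h.2 k hk h.1 hlk, fun h => h ▸ ⟨hlk, hk⟩⟩
          rw [this]
          exact hedge l k hlk x
        · have : G.neighborSet l ∩ A = ∅ := by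
            ext m
            simp only [Set.mem_inter_iff, SimpleGraph.mem_neighborSet, Set.mem_empty_iff_false,
              Finset.mem_coe, iff_false, not_and]
            exact fun h hm => hex ⟨m, hm, h⟩
          rw [this, insert_empty_eq]
          exact hnode l x
      have h2 := mul_pos hpos hpos2
      rw [← h1] at h2
      exact pos_of_mul_pos_left h2 (marg_nonneg hp0 _ _)

/-- The factor by which `p` changes when the value at `i` is altered depends only on `i` and its
neighbours; this is the cross-multiplied form. -/
theorem MarkovIn.mul_update (hM : MarkovIn p G Set.univ) (hp : ∀ x, 0 < p x) (i : Fin d)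
    {x y : Fin d → Fin r} (hxy : ∀ j ∈ insert i (G.neighborSet i), x j = y j) (c : Fin r) :
    p (Function.update x i c) * p y = p x * p (Function.update y i c) := by
  have key : ∀ x, p x * marg p (G.neighborSet i) x
      = marg p (Set.univ \ {i}) x * marg p (insert i (G.neighborSet i)) x := fun x => by
    have := hM i (Set.mem_univ i) x
    rwa [Set.inter_univ, marg_univ] at this
  have hoff : ∀ (x : Fin d → Fin r) {A : Set (Fin d)}, i ∉ A →
      marg p A (Function.update x i c) = marg p A x := fun x A hA =>
    marg_congr fun j hj => Function.update_of_ne (fun h : j = i => hA (h ▸ hj)) _ _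
  have hN : i ∉ G.neighborSet i := by simp
  have hU : i ∉ Set.univ \ {i} := by simp
  have k1 := key x
  have k2 := key y
  have k3 := key (Function.update x i c)
  have k4 := key (Function.update y i c)
  rw [hoff x hN, hoff x hU] at k3
  rw [hoff y hN, hoff y hU] at k4
  have e1 : marg p (G.neighborSet i) y = marg p (G.neighborSet i) x :=
    marg_congr fun j hj => (hxy j (Or.inr hj)).symm
  have e2 : marg p (insert i (G.neighborSet i)) y = marg p (insert i (G.neighborSet i)) x :=
    marg_congr fun j hj => (hxy j hj).symm
  have e3 : marg p (insert i (G.neighborSet i)) (Function.update y i c)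
      = marg p (insert i (G.neighborSet i)) (Function.update x i c) := by
    refine marg_congr fun j hj => ?_
    by_cases hji : j = i
    · subst hji; simp
    · rw [Function.update_of_ne hji, Function.update_of_ne hji]
      exact (hxy j hj).symm
  rw [e1, e2] at k2
  rw [e1, e3] at k4
  have hν := CLThres.marg_pos hp (G.neighborSet i) x
  set ν := marg p (G.neighborSet i) x
  refine mul_right_cancel₀ (mul_pos hν hν).ne' ?_
  linear_combination (p y * ν) * k3
    + (marg p (Set.univ \ {i}) x * marg p (insert i (G.neighborSet i)) (Function.update x i c)) * k2
    - (p (Function.update y i c) * ν) * k1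
    - (marg p (Set.univ \ {i}) x * marg p (insert i (G.neighborSet i)) x) * k4

/-- Iterates the one-site statement: rewriting sites of `S` changes `p` by a factor that depends
only on the values on `S` and its boundary. Positivity is used to cancel the intermediate
configurations. -/
theorem MarkovIn.mul_piecewise (hM : MarkovIn p G Set.univ) (hp : ∀ x, 0 < p x)
    {S D : Set (Fin d)} (hSD : ∀ i ∈ S, ∀ j ∉ S, G.Adj i j → j ∈ D) {x y : Fin d → Fin r}
    (hxy : ∀ j ∈ S ∪ D, x j = y j) (z : Fin d → Fin r) (B : Finset (Fin d)) (hB : ↑B ⊆ S) :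
    p (B.piecewise z x) * p y = p x * p (B.piecewise z y) := by
  classical
  induction B using Finset.induction_on with
  | empty => simp
  | insert i B hi ih =>
    rw [Finset.coe_insert, Set.insert_subset_iff] at hB
    have h1 := ih hB.2
    have h2 := hM.mul_update hp i (x := B.piecewise z x) (y := B.piecewise z y) (fun j hj => by
      by_cases hjB : j ∈ B
      · simp [hjB]
      · rw [Finset.piecewise_eq_of_notMem _ _ _ hjB, Finset.piecewise_eq_of_notMem _ _ _ hjB]
        refine hxy j ?_
        rcases hj with rfl | hj
        · exact Or.inl hB.1
        · by_cases hjS : j ∈ S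
          · exact Or.inl hjS
          · exact Or.inr (hSD i hB.1 j hjS hj)) (z i)
    rw [Finset.piecewise_insert, Finset.piecewise_insert]
    refine mul_right_cancel₀ (hp (B.piecewise z y)).ne' ?_
    linear_combination p y * h2 + p (Function.update (B.piecewise z y) i (z i)) * h1

/-- Global Markov property: `S` is independent of the rest given `D ⊇ ∂S`. -/
theorem MarkovIn.mul_marg_boundary (hM : MarkovIn p G Set.univ) (hp : ∀ x, 0 < p x)
    {S D : Set (Fin d)} (hdisj : Disjoint S D)
    (hSD : ∀ i ∈ S, ∀ j ∉ S, G.Adj i j → j ∈ D) (x : Fin d → Fin r) :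
    marg p Set.univ x * marg p D x = marg p (S ∪ D) x * marg p Sᶜ x := by
  classical
  have h1 : ∀ z : Fin d → Fin r, (∀ j ∉ S, z j = x j) →
      p x * marg p (S ∪ D) z = p z * marg p (S ∪ D) x := by
    intro z hz
    have hzx : S.toFinset.piecewise z x = z := by
      ext j
      by_cases hj : j ∈ S
      · simp [hj]
      · simp [hj, hz j hj]
    have hpw : ∀ y : Fin d → Fin r, (∀ j ∈ S ∪ D, y j = x j) →
        p z * p y = p x * p (S.toFinset.piecewise z y) := fun y hy => by
      have := hM.mul_piecewise hp hSD (x := x) (y := y) (fun j hj => (hy j hj).symm) z S.toFinset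
        (by simp)
      rwa [hzx] at this
    -- Overwriting the coordinates in `S` matches the configurations that agree with `x` on `S ∪ D`
    -- with those that agree with `z`.
    have hbij : marg p (S ∪ D) z
        = ∑ y, if ∀ j ∈ S ∪ D, y j = x j then p (S.toFinset.piecewise z y) else 0 := by
      have hm : marg p (S ∪ D) z = ∑ y with ∀ j ∈ S ∪ D, y j = z j, p y := by
        rw [Finset.sum_filter]
        refine Finset.sum_congr rfl fun y _ => ?_
        by_cases h : ∀ j ∈ S ∪ D, y j = z j
        · rw [if_pos h, if_pos h]
        · rw [if_neg h, if_neg h]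
      rw [hm, ← Finset.sum_filter]
      refine Finset.sum_bij' (fun w _ => S.toFinset.piecewise x w)
        (fun y _ => S.toFinset.piecewise z y) ?_ ?_ ?_ ?_ ?_
      · intro w hw
        simp only [Finset.mem_filter, Finset.mem_univ, true_and] at hw ⊢
        intro j hj
        by_cases hjS : j ∈ S
        · simp [hjS]
        · rw [Finset.piecewise_eq_of_notMem _ _ _ (by simpa using hjS), hw j hj, hz j hjS]
      · intro w hw
        simp only [Finset.mem_filter, Finset.mem_univ, true_and] at hw ⊢
        intro j hj
        by_cases hjS : j ∈ S
        · simp [hjS]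
        · rw [Finset.piecewise_eq_of_notMem _ _ _ (by simpa using hjS), hw j hj, hz j hjS]
      · intro w hw
        simp only [Finset.mem_filter, Finset.mem_univ, true_and] at hw
        ext j
        by_cases hjS : j ∈ S
        · simp [hjS, hw j (Or.inl hjS)]
        · simp [hjS]
      · intro w hw
        simp only [Finset.mem_filter, Finset.mem_univ, true_and] at hw
        ext j
        by_cases hjS : j ∈ S
        · simp [hjS, hw j (Or.inl hjS)]
        · simp [hjS]
      · intro w hw
        simp only [Finset.mem_filter, Finset.mem_univ, true_and] at hw
        congr 1
        ext j
        by_cases hjS : j ∈ S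
        · simp [hjS, hw j (Or.inl hjS)]
        · simp [hjS]
    rw [hbij]
    unfold marg
    rw [Finset.mul_sum, Finset.mul_sum]
    refine Finset.sum_congr rfl fun y _ => ?_
    split_ifs with hy
    · exact (hpw y hy).symm
    · simp
  have h2 : p x * sumOut S (marg p (S ∪ D)) x = sumOut S p x * marg p (S ∪ D) x := by
    unfold sumOut
    rw [Finset.mul_sum, Finset.sum_mul]
    refine Finset.sum_congr rfl fun z _ => ?_
    split_ifs with hz
    · exact h1 z hz
    · simp
  have h3 : sumOut S p x = marg p Sᶜ x := by
    have := sumOut_marg (p := p) (Set.subset_univ S) x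
    rw [← Set.compl_eq_univ_sdiff] at this
    rw [← this]
    congr 1
    ext y
    exact (marg_univ y).symm
  rw [sumOut_marg Set.subset_union_left, h3, Set.union_sdiff_cancel_left
    (Set.disjoint_iff.1 hdisj)] at h2
  rw [marg_univ, h2, mul_comm]

/-- Obtained from the full statement by summing out first `S \ A`, then `Sᶜ \ B`. -/
theorem MarkovIn.marg_union_mul (hM : MarkovIn p G Set.univ) (hp : ∀ x, 0 < p x)
    {S D : Set (Fin d)} (hdisj : Disjoint S D)
    (hSD : ∀ i ∈ S, ∀ j ∉ S, G.Adj i j → j ∈ D) {A B : Set (Fin d)} (hA : A ⊆ S) (hD : D ⊆ B)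
    (hB : B ⊆ Sᶜ) (x : Fin d → Fin r) :
    marg p (A ∪ B) x * marg p D x = marg p B x * marg p (A ∪ D) x := by
  have hSD' : ∀ k, k ∈ S → k ∉ D := fun k hk => Set.disjoint_left.1 hdisj hk
  have h1 := fun x => marg_mul_sdiff (hM.mul_marg_boundary hp hdisj hSD) (S := S \ A)
    (Set.subset_univ _) (Set.sdiff_subset.trans Set.subset_union_left)
    (hdisj.mono_left Set.sdiff_subset)
    (Set.disjoint_left.2 fun k hk hk' => hk' hk.1) x
  have e1 : (S ∪ D) \ (S \ A) = A ∪ D := by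
    ext k
    have h1 := @hA k
    have h2 := hSD' k
    simp only [Set.mem_sdiff, Set.mem_union]
    tauto
  simp only [e1] at h1
  have h2 := marg_mul_sdiff (S := Sᶜ \ B) (fun x => (h1 x).trans (mul_comm _ _))
    (fun k hk => ⟨Set.mem_univ k, fun h => hk.1 h.1⟩) Set.sdiff_subset
    (Set.disjoint_left.2 fun k hk hk' => hk.2 (hD hk'))
    (Set.disjoint_left.2 fun k hk hk' => hk'.elim (fun h => hk.1 (hA h)) fun h => hk.2 (hD h)) x
  have e2 : (Set.univ \ (S \ A)) \ (Sᶜ \ B) = A ∪ B := by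
    ext k
    have h1 := @hA k
    have h2 := @hB k
    simp only [Set.mem_sdiff, Set.mem_union, Set.mem_compl_iff, Set.mem_univ, true_and] at h2 ⊢
    tauto
  have e3 : Sᶜ \ (Sᶜ \ B) = B := by
    rw [Set.sdiff_sdiff_right_self, Set.inter_eq_right.2 hB]
  rw [e2, e3] at h2
  exact h2

end Markov


/-! ### Strict data processing inequality -/

section DataProcessing

variable {d r : ℕ}

/-- Joint law of three coordinates. -/
noncomputable def tripleLaw (p : (Fin d → Fin r) → ℝ) (i u j : Fin d) (a b c : Fin r) : ℝ :=
  ∑ x, if x i = a ∧ x u = b ∧ x j = c then p x else 0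

theorem marg_triple {p : (Fin d → Fin r) → ℝ} (i u j : Fin d) (x : Fin d → Fin r) :
    marg p {i, u, j} x = tripleLaw p i u j (x i) (x u) (x j) := by
  simp [marg, tripleLaw]

theorem sum_tripleLaw_mul (p : (Fin d → Fin r) → ℝ) (i u j : Fin d)
    (F : Fin r → Fin r → Fin r → ℝ) :
    ∑ a, ∑ b, ∑ c, tripleLaw p i u j a b c * F a b c = ∑ x, p x * F (x i) (x u) (x j) := by
  simp only [tripleLaw, Finset.sum_mul]
  rw [Finset.sum_congr rfl fun a _ => Finset.sum_congr rfl fun b _ => Finset.sum_comm,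
    Finset.sum_congr rfl fun a _ => Finset.sum_comm, Finset.sum_comm]
  refine Finset.sum_congr rfl fun x _ => ?_
  simp [ite_mul, ite_and]

theorem exists_eq_three {i u j : Fin d} (hiu : i ≠ u) (hij : i ≠ j) (huj : u ≠ j) (a b c : Fin r) :
    ∃ x : Fin d → Fin r, x i = a ∧ x u = b ∧ x j = c :=
  ⟨fun k => if k = i then a else if k = u then b else c, by simp, by simp [hiu.symm],
    by simp [hij.symm, huj.symm]⟩

/-- Data processing inequality along `i - u - j`, strict unless `u` and `j` are independent. -/
theorem pairInfo_le_of_condIndep {p : (Fin d → Fin r) → ℝ}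
    (hp : p ∈ stdSimplex ℝ (Fin d → Fin r)) (hpos : ∀ x, 0 < p x) {i u j : Fin d} (hiu : i ≠ u)
    (hij : i ≠ j) (huj : u ≠ j)
    (hind : ∀ x, marg p {i, u, j} x * marg p {u} x = marg p {u, j} x * marg p {i, u} x) :
    pairInfo p i j ≤ pairInfo p u j ∧ (0 < pairInfo p u j → pairInfo p i j < pairInfo p u j) := by
  have hex := fun a b c => exists_eq_three (r := r) hiu hij huj a b c
  have hpi : ∀ a, 0 < nodeLaw p i a := fun a => by
    obtain ⟨x, h1, -, -⟩ := hex a a a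
    rw [← h1, ← marg_singleton]
    exact marg_pos hpos _ _
  have hpu : ∀ a, 0 < nodeLaw p u a := fun a => by
    obtain ⟨x, -, h1, -⟩ := hex a a a
    rw [← h1, ← marg_singleton]
    exact marg_pos hpos _ _
  have hpj : ∀ a, 0 < nodeLaw p j a := fun a => by
    obtain ⟨x, -, -, h1⟩ := hex a a a
    rw [← h1, ← marg_singleton]
    exact marg_pos hpos _ _
  have hpuj : ∀ b c, 0 < pairLaw p u j b c := fun b c => by
    obtain ⟨x, -, h1, h2⟩ := hex b b c
    rw [← h1, ← h2, ← marg_pair]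
    exact marg_pos hpos _ _
  have hpij : ∀ a c, 0 < pairLaw p i j a c := fun b c => by
    obtain ⟨x, h1, -, h2⟩ := hex b b c
    rw [← h1, ← h2, ← marg_pair]
    exact marg_pos hpos _ _
  have htri : ∀ a b c, tripleLaw p i u j a b c * nodeLaw p u b
      = pairLaw p u j b c * pairLaw p i u a b := fun a b c => by
    obtain ⟨x, rfl, rfl, rfl⟩ := hex a b c
    rw [← marg_triple, ← marg_singleton, ← marg_pair, ← marg_pair]
    exact hind x
  -- Under `R` the coordinates `u` and `j` become conditionally independent given `i`, and `D(p ‖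
  -- R)` is exactly the difference of the two mutual informations.
  set R : (Fin d → Fin r) → ℝ := fun x => p x * (nodeLaw p u (x u) * pairLaw p i j (x i) (x j)
    / (pairLaw p u j (x u) (x j) * nodeLaw p i (x i))) with hR
  have hRpos : ∀ x, 0 < R x := fun x => mul_pos (hpos x)
    (div_pos (mul_pos (hpu _) (hpij _ _)) (mul_pos (hpuj _ _) (hpi _)))
  have hR1 : ∑ x, R x = 1 := by
    rw [← sum_tripleLaw_mul p i u j fun a b c => nodeLaw p u b * pairLaw p i j a c
      / (pairLaw p u j b c * nodeLaw p i a), ← (nodeLaw_mem_stdSimplex hp i).2]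
    refine Finset.sum_congr rfl fun a _ => ?_
    have h1 : ∀ b c, tripleLaw p i u j a b c * (nodeLaw p u b * pairLaw p i j a c
        / (pairLaw p u j b c * nodeLaw p i a))
        = pairLaw p i u a b * pairLaw p i j a c / nodeLaw p i a := fun b c => by
      have h2 := (hpuj b c).ne'
      have h3 := (hpi a).ne'
      rw [mul_div_assoc', div_eq_div_iff (mul_ne_zero h2 h3) h3, ← mul_assoc, htri]
      ring
    simp only [h1]
    rw [Finset.sum_congr rfl fun b _ => (Finset.sum_div _ _ _).symm, ← Finset.sum_div]
    simp only [← Finset.mul_sum, sum_pairLaw_right]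
    rw [← Finset.sum_mul, sum_pairLaw_right, mul_div_assoc, div_self (hpi a).ne', mul_one]
  have hdiff : relEntropy p R = pairInfo p u j - pairInfo p i j := by
    have e : ∀ k l, pairInfo p k l = ∑ x, p x * Real.log (pairLaw p k l (x k) (x l)
        / (nodeLaw p k (x k) * nodeLaw p l (x l))) := fun k l => by
      rw [← sum_pairLaw_mul p k l fun a b => Real.log (pairLaw p k l a b
        / (nodeLaw p k a * nodeLaw p l b))]
      unfold pairInfo mutualInfo
      simp only [sum_pairLaw_right, sum_pairLaw_left]
    rw [e, e, ← Finset.sum_sub_distrib]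
    refine Finset.sum_congr rfl fun x _ => ?_
    have h1 := hpos x
    have h2 := hpu (x u)
    have h3 := hpi (x i)
    have h4 := hpj (x j)
    have h5 := hpuj (x u) (x j)
    have h6 := hpij (x i) (x j)
    simp only [hR]
    rw [Real.log_div h1.ne' (by positivity), Real.log_mul h1.ne' (by positivity),
      Real.log_div (by positivity) (by positivity), Real.log_mul h2.ne' h6.ne',
      Real.log_mul h5.ne' h3.ne', Real.log_div h5.ne' (by positivity),
      Real.log_mul h2.ne' h4.ne', Real.log_div h6.ne' (by positivity), Real.log_mul h3.ne' h4.ne']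
    ring
  refine ⟨by linarith [relEntropy_nonneg hp (fun x => (hRpos x).le) hR1.le fun x _ => hRpos x],
    fun hinfo => ?_⟩
  by_contra hcon
  have hle : relEntropy p R ≤ 0 := by linarith [not_lt.1 hcon]
  have heq := eq_of_relEntropy_nonpos hp ⟨fun x => (hRpos x).le, hR1⟩ (fun x _ => hRpos x) hle
  -- In the equality case `p = R`; summing over `a` makes `u` and `j` independent.
  have h1 : ∀ a b c, pairLaw p u j b c * nodeLaw p i a = nodeLaw p u b * pairLaw p i j a c := by
    intro a b c
    obtain ⟨x, rfl, rfl, rfl⟩ := hex a b c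
    have h2 := congrFun heq x
    simp only [hR] at h2
    have h3 : nodeLaw p u (x u) * pairLaw p i j (x i) (x j)
        / (pairLaw p u j (x u) (x j) * nodeLaw p i (x i)) = 1 :=
      mul_left_cancel₀ (hpos x).ne' (by rw [← h2, mul_one])
    exact ((div_eq_one_iff_eq (mul_pos (hpuj _ _) (hpi _)).ne').1 h3).symm
  have h2 : ∀ b c, pairLaw p u j b c = nodeLaw p u b * nodeLaw p j c := fun b c => by
    have := Finset.sum_congr rfl fun a (_ : a ∈ Finset.univ) => h1 a b c
    rwa [← Finset.mul_sum, ← Finset.mul_sum, sum_pairLaw_left, (nodeLaw_mem_stdSimplex hp i).2,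
      mul_one] at this
  refine hinfo.ne' ?_
  unfold pairInfo mutualInfo
  refine Finset.sum_eq_zero fun b _ => Finset.sum_eq_zero fun c _ => ?_
  rw [sum_pairLaw_right, sum_pairLaw_left, h2, div_self (mul_pos (hpu b) (hpj c)).ne', Real.log_one,
    mul_zero]

end DataProcessing

/-! ### Consequences of the forest model for the true distribution -/

section ForestModel

variable {d r : ℕ} {P : Measure (Fin d → Fin r)} [IsProbabilityMeasure P]
  {G : SimpleGraph (Fin d)}

/-- Probability mass function of `P`. -/
noncomputable def massFun (P : Measure (Fin d → Fin r)) (x : Fin d → Fin r) : ℝ := P.real {x}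

theorem measureReal_setOf (Q : (Fin d → Fin r) → Prop) [DecidablePred Q] :
    P.real {x | Q x} = ∑ x, if Q x then massFun P x else 0 := by
  rw [← Finset.sum_filter]
  unfold massFun
  rw [sum_measureReal_singleton]
  simp

theorem marginal_eq_marg (S : Set (Fin d)) (x : Fin d → Fin r) :
    marginal P S x = marg (massFun P) S x := by
  classical
  unfold marginal marg
  exact measureReal_setOf _

theorem massFun_mem_stdSimplex : massFun P ∈ stdSimplex ℝ (Fin d → Fin r) := by
  refine ⟨fun x => measureReal_nonneg, ?_⟩
  have := measureReal_setOf (P := P) fun _ => True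
  simpa using this.symm

theorem IsMarkovOn.markovIn (h : IsMarkovOn P G) : MarkovIn (massFun P) G Set.univ := by
  intro i _ x
  have hp0 := (massFun_mem_stdSimplex (P := P)).1
  rw [Set.inter_univ, ← Set.compl_eq_univ_sdiff]
  rcases (marg_nonneg hp0 {i}ᶜ x).eq_or_lt with h0 | h0
  · have : marg (massFun P) Set.univ x = 0 :=
      le_antisymm ((marg_mono hp0 (Set.subset_univ _) x).trans h0.ge) (marg_nonneg hp0 _ _)
    rw [this, ← h0]
    ring
  · have hN : 0 < marg (massFun P) (G.neighborSet i) x :=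
      h0.trans_le (marg_mono hp0 (by simp) x)
    have := h i x (by rwa [marginal_eq_marg])
    simp only [marginal_eq_marg] at this
    rw [div_eq_div_iff hN.ne' h0.ne'] at this
    linarith

theorem MarkovIn.isMarkovOn (h : MarkovIn (massFun P) G Set.univ) (hpos : ∀ x, 0 < massFun P x) :
    IsMarkovOn P G := by
  intro i x _
  have := h i (Set.mem_univ i) x
  rw [Set.inter_univ, ← Set.compl_eq_univ_sdiff] at this
  simp only [marginal_eq_marg]
  rw [div_eq_div_iff (CLThres.marg_pos hpos _ _).ne' (CLThres.marg_pos hpos _ _).ne']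
  linarith

theorem IsForestModel.massFun_pos (h : IsForestModel P G) (x : Fin d → Fin r) :
    0 < massFun P x := by
  rw [← marg_univ (p := massFun P), ← Finset.coe_univ]
  have hmem := massFun_mem_stdSimplex (P := P)
  refine MarkovIn.marg_pos h.acyclic hmem.2 hmem.1 ?_ ?_ _ (by
    rw [Finset.coe_univ]; exact h.markov.markovIn) x
  · intro i x
    rw [marg_singleton, nodeLaw, ← measureReal_setOf]
    exact h.node_pos i _
  · intro i j hij x
    rw [marg_pair, pairLaw, ← measureReal_setOf]
    exact h.edge_pos i j hij _ _

/-- A connected component has empty boundary, so the global Markov property applies with `D = ∅`. -/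
theorem IsForestModel.pairLaw_eq_mul (h : IsForestModel P G) {i j : Fin d}
    (hij : ¬G.Reachable i j) (a b : Fin r) :
    pairLaw (massFun P) i j a b = nodeLaw (massFun P) i a * nodeLaw (massFun P) j b := by
  have hne : i ≠ j := by rintro rfl; exact hij (SimpleGraph.Reachable.refl _)
  have hmem := massFun_mem_stdSimplex (P := P)
  have key := h.markov.markovIn.marg_union_mul h.massFun_pos (S := {k | G.Reachable i k}) (D := ∅)
    (by simp) (fun k hk l hl hkl => absurd (hk.trans hkl.reachable) hl) (A := {i}) (B := {j})
    (by simp) (by simp) (by simpa using hij)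
  have hx := key fun k => if k = i then a else b
  rw [marg_empty hmem.2, Set.singleton_union, marg_pair, Set.union_empty, marg_singleton,
    marg_singleton] at hx
  simp only [if_true, hne.symm, if_false] at hx
  linarith

theorem adj_compl_side (hG : G.IsAcyclic) {u v : Fin d} (huv : G.Adj u v) :
    ∀ i ∈ (side G u v)ᶜ, ∀ j ∉ (side G u v)ᶜ, G.Adj i j → j ∈ ({u} : Set (Fin d)) :=
  fun _ hi _ hj hij => (eq_of_adj_side hG huv (not_not.1 hj) hi hij.symm).1

/-- If the ends of an edge are independent, the edge is not needed at its first vertex. -/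
theorem IsForestModel.markov_of_pairInfo_nonpos (h : IsForestModel P G) {u v : Fin d}
    (huv : G.Adj u v) (hI : pairInfo (massFun P) u v ≤ 0) (x : Fin d → Fin r) :
    marg (massFun P) Set.univ x * marg (massFun P) (G.neighborSet u \ {v}) x
      = marg (massFun P) {u}ᶜ x * marg (massFun P) (insert u (G.neighborSet u \ {v})) x := by
  have hpos := h.massFun_pos
  have hmem := massFun_mem_stdSimplex (P := P)
  have hv := notMem_side h.acyclic huv
  set N := G.neighborSet u \ {v} with hN
  have hNS : insert u N ⊆ side G u v := by
    rintro k (rfl | hk)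
    · exact mem_side_self G _ v
    · refine SimpleGraph.Adj.reachable (SimpleGraph.deleteEdges_adj.2 ⟨hk.1, fun he => ?_⟩)
      rcases Sym2.eq_iff.1 (Set.mem_singleton_iff.1 he) with h1 | h1
      · exact hk.2 h1.2
      · exact huv.ne h1.1
  have hu : u ∉ N := fun hu => G.irrefl hu.1
  have hvN : v ∉ N := fun hv => hv.2 rfl
  -- Given `u`, `v` is independent of the other neighbours, and it is independent of `u`; hence it
  -- is independent of all of them jointly and drops out of the Markov property at `u`.
  have h1 : ∀ x, marg (massFun P) (insert v (insert u N)) x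
      = marg (massFun P) (insert u N) x * marg (massFun P) {v} x := by
    intro x
    have key := h.markov.markovIn.marg_union_mul hpos (S := (side G u v)ᶜ) (D := {u})
      (by simpa using mem_side_self G u v) (adj_compl_side h.acyclic huv) (A := {v})
      (B := insert u N) (by simpa using hv) (by simp) (by rwa [compl_compl]) x
    have hprod : marg (massFun P) {v, u} x = marg (massFun P) {v} x * marg (massFun P) {u} x := by
      rw [Set.pair_comm, marg_pair, marg_singleton, marg_singleton,
        pairLaw_eq_mul_of_pairInfo_nonpos hmem hI, mul_comm]
    rw [Set.singleton_union, Set.singleton_union, hprod] at key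
    refine mul_right_cancel₀ (marg_pos hpos {u} x).ne' ?_
    linarith
  have h2 : ∀ x, marg (massFun P) (insert v N) x
      = marg (massFun P) N x * marg (massFun P) {v} x := by
    intro x
    have := marg_mul_sdiff (p := massFun P) (S := {u}) (A := insert v (insert u N))
      (B := ∅) (A' := insert u N) (B' := {v}) (fun x => by rw [marg_empty hmem.2, mul_one, h1])
      (by simp) (by simp) (by simp) (by simpa using huv.ne) x
    have e1 : insert v (insert u N) \ {u} = insert v N := by
      rw [Set.insert_comm, Set.insert_sdiff_self_of_notMem]
      rintro (h | h)
      · exact huv.ne h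
      · exact hu h
    rw [e1, Set.insert_sdiff_self_of_notMem hu, marg_empty hmem.2, mul_one] at this
    exact this
  have h3 := h.markov.markovIn u (Set.mem_univ u) x
  have e2 : G.neighborSet u = insert v N := by
    rw [hN, Set.insert_sdiff_singleton, Set.insert_eq_of_mem]
    exact huv
  rw [Set.inter_univ, ← Set.compl_eq_univ_sdiff, e2, Set.insert_comm, h1, h2] at h3
  refine mul_right_cancel₀ (marg_pos hpos {v} x).ne' ?_
  linarith

/-- If `u` and `v` were independent, `P` would be Markov on `G` without this edge, contradicting
minimality. Only the neighbourhoods of `u` and `v` change. -/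
theorem IsForestModel.pairInfo_pos (h : IsForestModel P G) {u v : Fin d} (huv : G.Adj u v) :
    0 < pairInfo (massFun P) u v := by
  by_contra hcon
  have hI := not_lt.1 hcon
  have hI' : pairInfo (massFun P) v u ≤ 0 := by rwa [pairInfo_comm]
  have hM : IsMarkovOn P (G.deleteEdges {s(u, v)}) := by
    refine MarkovIn.isMarkovOn (fun i _ x => ?_) h.massFun_pos
    rw [Set.inter_univ, ← Set.compl_eq_univ_sdiff]
    by_cases hiu : i = u
    · subst hiu
      have : (G.deleteEdges {s(i, v)}).neighborSet i = G.neighborSet i \ {v} := by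
        ext k
        simp only [SimpleGraph.mem_neighborSet, SimpleGraph.deleteEdges_adj, Set.mem_sdiff,
          Set.mem_singleton_iff, Sym2.congr_right]
      rw [this]
      exact h.markov_of_pairInfo_nonpos huv hI x
    · by_cases hiv : i = v
      · subst hiv
        have : (G.deleteEdges {s(u, i)}).neighborSet i = G.neighborSet i \ {u} := by
          ext k
          rw [Sym2.eq_swap]
          simp only [SimpleGraph.mem_neighborSet, SimpleGraph.deleteEdges_adj, Set.mem_sdiff,
            Set.mem_singleton_iff, Sym2.congr_right]
        rw [this]
        exact h.markov_of_pairInfo_nonpos huv.symm hI' x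
      · have : (G.deleteEdges {s(u, v)}).neighborSet i = G.neighborSet i := by
          ext k
          simp only [SimpleGraph.mem_neighborSet, SimpleGraph.deleteEdges_adj,
            Set.mem_singleton_iff, Sym2.eq_iff]
          tauto
        rw [this]
        have := h.markov.markovIn i (Set.mem_univ i) x
        rwa [Set.inter_univ, ← Set.compl_eq_univ_sdiff] at this
  have hle := h.minimal _ hM
  rw [SimpleGraph.edgeSet_deleteEdges] at hle
  exact absurd hle (not_le.2 (Set.ncard_sdiff_singleton_lt_of_mem
    ((SimpleGraph.mem_edgeSet _).2 huv) (Set.toFinite _)))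

/-- Mutual information decreases strictly along the paths of the forest. -/
theorem IsForestModel.pairInfo_lt (h : IsForestModel P G) {u v i j : Fin d} (huv : G.Adj u v)
    (hi : i ∈ side G u v) (hj : j ∉ side G u v) (hne : s(i, j) ≠ s(u, v)) :
    pairInfo (massFun P) i j < pairInfo (massFun P) u v := by
  have hpos := h.massFun_pos
  have hmem := massFun_mem_stdSimplex (P := P)
  have hv := notMem_side h.acyclic huv
  have hu := mem_side_self G u v
  have hij : i ≠ j := fun he => hj (he ▸ hi)
  have huj : u ≠ j := fun he => hj (he ▸ hu)
  have hiv : i ≠ v := fun he => hv (he ▸ hi)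
  -- The chain is `I(i, j) ≤ I(u, j) ≤ I(u, v)`, by data processing along `i - u - j` and `u - v -
  -- j`. Since the pairs differ, at least one step is not trivial; the second is strict if `j ≠ v`,
  -- the first if `j = v`.
  have step : j ≠ v → pairInfo (massFun P) u j < pairInfo (massFun P) u v := by
    intro hjv
    rw [pairInfo_comm _ u j, pairInfo_comm _ u v]
    refine (pairInfo_le_of_condIndep hmem hpos hjv huj.symm huv.ne' (fun x => ?_)).2
      (by rw [pairInfo_comm]; exact h.pairInfo_pos huv)
    have key := h.markov.markovIn.marg_union_mul hpos (S := side G u v) (D := {v})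
      (by simpa using hv)
      (fun k hk l hl hkl => (eq_of_adj_side h.acyclic huv hk hl hkl).2) (A := {u})
      (B := {v, j}) (by simpa using hu) (by simp) (by
        rintro k (rfl | rfl)
        · exact hv
        · exact hj) x
    have e1 : ({j, v, u} : Set (Fin d)) = {u} ∪ {v, j} := by
      ext k
      simp only [Set.mem_insert_iff, Set.mem_singleton_iff, Set.mem_union]
      tauto
    rw [e1, key, Set.singleton_union, Set.pair_comm v j, Set.pair_comm u v, mul_comm]
  by_cases hiu : i = u
  · subst hiu
    exact step fun hjv => hne (by rw [hjv])
  · have key := pairInfo_le_of_condIndep hmem hpos hiu hij huj fun x => by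
      have key := h.markov.markovIn.marg_union_mul hpos (S := (side G u v)ᶜ) (D := {u})
        (by simpa using hu) (adj_compl_side h.acyclic huv) (A := {j}) (B := {u, i})
        (by simpa using hj) (by simp) (by
          rw [compl_compl]
          rintro k (rfl | rfl)
          · exact hu
          · exact hi) x
      have e1 : ({i, u, j} : Set (Fin d)) = {j} ∪ {u, i} := by
        ext k
        simp only [Set.mem_insert_iff, Set.mem_singleton_iff, Set.mem_union]
        tauto
      rw [e1, key, Set.singleton_union, Set.pair_comm u i, Set.pair_comm j u, mul_comm]
    by_cases hjv : j = v
    · subst hjv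
      exact key.2 (h.pairInfo_pos huv)
    · exact key.1.trans_lt (step hjv)

end ForestModel


/-! ### Asymptotics of the regularization sequence -/

section Asymptotics

variable {ε : ℕ → ℝ}

theorem IsRegularization.tendsto_mul (hε : IsRegularization ε) :
    Tendsto (fun n : ℕ => n * ε n) atTop atTop := by
  have hlog : Tendsto (fun n : ℕ => Real.log n) atTop atTop :=
    Real.tendsto_log_atTop.comp tendsto_natCast_atTop_atTop
  refine (hε.2.atTop_mul_atTop₀ hlog).congr' ?_
  filter_upwards [hlog.eventually_gt_atTop 0] with n hn
  field_simp

theorem IsRegularization.eventually_pos (hε : IsRegularization ε) : ∀ᶠ n in atTop, 0 < ε n := by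
  filter_upwards [hε.tendsto_mul.eventually_gt_atTop 0] with n hn
  exact pos_of_mul_pos_right hn (Nat.cast_nonneg n)

theorem eventually_log_succ_le : ∀ᶠ n : ℕ in atTop, Real.log (n + 1) ≤ 2 * Real.log n := by
  filter_upwards [eventually_ge_atTop 2] with n hn
  have hn' : (2 : ℝ) ≤ n := by exact_mod_cast hn
  rw [show 2 * Real.log n = Real.log ((n : ℝ) ^ 2) by rw [Real.log_pow]; norm_num]
  exact Real.log_le_log (by positivity) (by nlinarith)

theorem IsRegularization.tendsto_log_div (hε : IsRegularization ε) :
    Tendsto (fun n : ℕ => Real.log (n + 1) / (n * ε n)) atTop (𝓝 0) := by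
  have h1 : Tendsto (fun n : ℕ => 2 * (n * ε n / Real.log n)⁻¹) atTop (𝓝 0) := by
    simpa using (tendsto_inv_atTop_zero.comp hε.2).const_mul 2
  refine squeeze_zero' ?_ ?_ h1
  · filter_upwards [hε.tendsto_mul.eventually_gt_atTop 0] with n hn
    exact div_nonneg (Real.log_nonneg (by simp)) hn.le
  · filter_upwards [hε.tendsto_mul.eventually_gt_atTop 0, eventually_log_succ_le] with n hn hlog
    rw [inv_div, mul_div_assoc']
    exact div_le_div_of_nonneg_right hlog hn.le

theorem tendsto_log_succ_div : Tendsto (fun n : ℕ => Real.log (n + 1) / n) atTop (𝓝 0) := by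
  have h1 : Tendsto (fun n : ℕ => 2 * (Real.log n / n)) atTop (𝓝 0) := by
    simpa using ((Real.isLittleO_log_id_atTop.tendsto_div_nhds_zero).comp
      tendsto_natCast_atTop_atTop).const_mul 2
  refine squeeze_zero' (Eventually.of_forall fun n => ?_) ?_ h1
  · exact div_nonneg (Real.log_nonneg (by simp)) (Nat.cast_nonneg n)
  · filter_upwards [eventually_log_succ_le] with n hlog
    rw [mul_div_assoc']
    exact div_le_div_of_nonneg_right hlog (Nat.cast_nonneg n)

theorem pow_mul_exp_eq (n N : ℕ) (c : ℝ) :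
    ((n : ℝ) + 1) ^ N * Real.exp (-(n * c)) = Real.exp (N * Real.log (n + 1) - n * c) := by
  have h : (0 : ℝ) < n + 1 := by positivity
  rw [sub_eq_add_neg, Real.exp_add, ← Real.log_pow, Real.exp_log (pow_pos h N)]

/-- Here the growth of `n * ε n / log n` beats the number of types, so that events of exponent `ε n`
are negligible. -/
theorem IsRegularization.tendsto_pow_mul_exp (hε : IsRegularization ε) (N : ℕ) :
    Tendsto (fun n : ℕ => ((n : ℝ) + 1) ^ N * Real.exp (-(n * ε n))) atTop (𝓝 0) := by
  simp only [pow_mul_exp_eq]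
  refine Real.tendsto_exp_atBot.comp ?_
  have h1 : Tendsto (fun n : ℕ => N * (Real.log (n + 1) / (n * ε n)) - 1) atTop (𝓝 (-1)) := by
    simpa using (hε.tendsto_log_div.const_mul (N : ℝ)).sub_const 1
  refine (hε.tendsto_mul.atTop_mul_neg (by norm_num) h1).congr' ?_
  filter_upwards [hε.tendsto_mul.eventually_gt_atTop 0] with n hn
  rw [mul_sub, mul_one, mul_left_comm, mul_div_cancel₀ _ hn.ne']

theorem mul_log_ofReal_le {k a b : ℝ} (hk : 0 < k) (h : a ≤ Real.exp b) :
    (k : EReal) * ENNReal.log (ENNReal.ofReal a) ≤ ((k * b : ℝ) : EReal) := by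
  rcases le_or_gt a 0 with ha | ha
  · rw [ENNReal.log_ofReal, if_pos ha, EReal.coe_mul_bot_of_pos hk]
    exact bot_le
  · rw [ENNReal.log_ofReal_of_pos ha, ← EReal.coe_mul, EReal.coe_le_coe_iff]
    exact mul_le_mul_of_nonneg_left ((Real.log_le_iff_le_exp ha).2 h) hk.le

theorem le_mul_log_ofReal {k a b : ℝ} (hk : 0 ≤ k) (ha : 0 < a) (h : b ≤ Real.log a) :
    ((k * b : ℝ) : EReal) ≤ (k : EReal) * ENNReal.log (ENNReal.ofReal a) := by
  rw [ENNReal.log_ofReal_of_pos ha, ← EReal.coe_mul, EReal.coe_le_coe_iff]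
  exact mul_le_mul_of_nonneg_left h hk

end Asymptotics

/-! ### Bounds for the error probability -/

section Bounds

variable {d r : ℕ} {p q : (Fin d → Fin r) → ℝ}

theorem measure_pi_eq_sampleProb (P : Measure (Fin d → Fin r)) [IsProbabilityMeasure P] {n : ℕ}
    (S : Set (Fin n → Fin d → Fin r)) :
    Measure.pi (fun _ : Fin n => P) S = ENNReal.ofReal (sampleProb (massFun P) S) := by
  classical
  rw [← ofReal_measureReal]
  congr 1
  have h : S = ((Finset.univ.filter fun x => x ∈ S : Finset (Fin n → Fin d → Fin r)) : Set _) := by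
    simp
  conv_lhs => rw [h]
  rw [← sum_measureReal_singleton, Finset.sum_filter]
  refine Finset.sum_congr rfl fun x _ => ?_
  by_cases hx : x ∈ S
  · rw [if_pos hx, Set.indicator_of_mem hx]
    simp [massFun, measureReal_def, Measure.pi_singleton, ENNReal.toReal_prod]
  · rw [if_neg hx, Set.indicator_of_notMem hx]

/-- Lower bound by change of measure. -/
theorem le_log_sampleProb (hp : p ∈ stdSimplex ℝ (Fin d → Fin r)) (hpos : ∀ x, 0 < p x)
    (hq : q ∈ stdSimplex ℝ (Fin d → Fin r)) {n : ℕ} {S A : Set (Fin n → Fin d → Fin r)}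
    (hSA : S ⊆ A) {s : ℝ} (hs : 0 < s) (hsS : s ≤ sampleProb q S) :
    0 < sampleProb p A ∧ -((n * relEntropy q p + Real.log 2) / s) ≤ Real.log (sampleProb p A) := by
  have hne : S.Nonempty := by
    by_contra hcon
    rw [Set.not_nonempty_iff_eq_empty.1 hcon] at hsS
    simp only [sampleProb, Set.indicator_empty, Finset.sum_const_zero] at hsS
    linarith
  have hSpos : 0 < sampleProb p S := by
    obtain ⟨x, hx⟩ := hne
    have hP : ∀ x : Fin n → Fin d → Fin r, 0 < ∏ l, p (x l) := fun x =>
      Finset.prod_pos fun l _ => hpos _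
    refine Finset.sum_pos' (fun y _ => Set.indicator_nonneg (fun z _ => (hP z).le) _)
      ⟨x, Finset.mem_univ _, ?_⟩
    rw [Set.indicator_of_mem hx]
    exact hP x
  have hmono := sampleProb_mono hp.1 hSA
  have hS1 : sampleProb p S ≤ 1 := by
    linarith [sampleProb_compl hp S, sampleProb_nonneg hp.1 Sᶜ]
  refine ⟨hSpos.trans_le hmono, le_trans ?_ (Real.log_le_log hSpos hmono)⟩
  have key := neg_mul_log_sampleProb_le hp hq hpos hne
  have hlog : 0 ≤ -Real.log (sampleProb p S) := by linarith [Real.log_nonpos hSpos.le hS1]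
  have h1 : s * -Real.log (sampleProb p S) ≤ n * relEntropy q p + Real.log 2 :=
    (mul_le_mul_of_nonneg_right hsS hlog).trans (by linarith)
  rw [neg_le, le_div_iff₀ hs]
  linarith

/-- Sanov's bound under `q` itself, applied to the complement: it certifies that an event is typical
under `q`. -/
theorem one_sub_le_sampleProb (hq : q ∈ stdSimplex ℝ (Fin d → Fin r)) {n : ℕ} (hn : n ≠ 0)
    (U : Set ((Fin d → Fin r) → ℝ)) {c : ℝ}
    (hU : ∀ T ∈ stdSimplex ℝ (Fin d → Fin r), (∀ x, 0 < T x → 0 < q x) → T ∉ U →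
      c ≤ relEntropy T q) :
    1 - ((n : ℝ) + 1) ^ Fintype.card (Fin d → Fin r) * Real.exp (-(n * c))
      ≤ sampleProb q {x : Fin n → Fin d → Fin r | empirical x ∈ U} := by
  have h1 := sampleProb_compl hq {x : Fin n → Fin d → Fin r | empirical x ∈ U}
  have h2 := sampleProb_le_of_relEntropy hn hq.1
    (S := {x : Fin n → Fin d → Fin r | empirical x ∈ U}ᶜ) (c := c)
    fun x hx hac => hU _ (empirical_mem_stdSimplex hn x) hac hx
  linarith

/-- The distributions for which an edge of `G` is not stronger than a competing pair, or is at
most `η`. -/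
def IsConfusable (G : SimpleGraph (Fin d)) (η : ℝ) (q : (Fin d → Fin r) → ℝ) : Prop :=
  (∃ u v i j, (G.Adj u v ∧ i ∈ side G u v ∧ j ∉ side G u v ∧ s(i, j) ≠ s(u, v)) ∧
    pairInfo q u v ≤ pairInfo q i j) ∨ ∃ u v, G.Adj u v ∧ pairInfo q u v ≤ η

theorem isCompact_confusable (G : SimpleGraph (Fin d)) (η : ℝ) :
    IsCompact {q | q ∈ stdSimplex ℝ (Fin d → Fin r) ∧ IsConfusable G η q} := by
  refine (isCompact_stdSimplex ℝ (Fin d → Fin r)).of_isClosed_subset ?_ fun q hq => hq.1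
  have hcl : IsClosed (stdSimplex ℝ (Fin d → Fin r)) := (isCompact_stdSimplex ℝ _).isClosed
  have h : {q | q ∈ stdSimplex ℝ (Fin d → Fin r) ∧ IsConfusable G η q}
      = (⋃ z ∈ {z : Fin d × Fin d × Fin d × Fin d | G.Adj z.1 z.2.1 ∧ z.2.2.1 ∈ side G z.1 z.2.1 ∧
          z.2.2.2 ∉ side G z.1 z.2.1 ∧ s(z.2.2.1, z.2.2.2) ≠ s(z.1, z.2.1)},
          {q ∈ stdSimplex ℝ (Fin d → Fin r) | pairInfo q z.1 z.2.1 ≤ pairInfo q z.2.2.1 z.2.2.2})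
        ∪ ⋃ z ∈ {z : Fin d × Fin d | G.Adj z.1 z.2},
          {q ∈ stdSimplex ℝ (Fin d → Fin r) | pairInfo q z.1 z.2 ≤ η} := by
    ext q
    simp only [IsConfusable, Set.mem_ofPred_eq, Set.mem_union, Set.mem_iUnion, Prod.exists,
      exists_prop]
    constructor
    · rintro ⟨hq, ⟨u, v, i, j, h1, h2⟩ | ⟨u, v, h1, h2⟩⟩
      · exact Or.inl ⟨u, v, i, j, h1, hq, h2⟩
      · exact Or.inr ⟨u, v, h1, hq, h2⟩
    · rintro (⟨u, v, i, j, h1, hq, h2⟩ | ⟨u, v, h1, hq, h2⟩)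
      · exact ⟨hq, Or.inl ⟨u, v, i, j, h1, h2⟩⟩
      · exact ⟨hq, Or.inr ⟨u, v, h1, h2⟩⟩
  rw [h]
  refine IsClosed.union ?_ ?_
  · exact (Set.toFinite _).isClosed_biUnion fun z _ =>
      hcl.isClosed_le (continuousOn_pairInfo _ _) (continuousOn_pairInfo _ _)
  · exact (Set.toFinite _).isClosed_biUnion fun z _ =>
      hcl.isClosed_le (continuousOn_pairInfo _ _) continuousOn_const

/-- On the compact set `{D(q ‖ p) ≤ c}` the information of each edge attains a minimum, which is
positive by hypothesis; any `η` below all these minima works. -/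
theorem eventually_lt_relEntropy (hpos : ∀ x, 0 < p x) {G : SimpleGraph (Fin d)} {c : ℝ}
    (hc : ∀ q ∈ stdSimplex ℝ (Fin d → Fin r), IsConfusable G 0 q → c < relEntropy q p) :
    ∀ᶠ η in 𝓝 (0 : ℝ), ∀ q ∈ stdSimplex ℝ (Fin d → Fin r), IsConfusable G η q →
      c < relEntropy q p := by
  have h : ∀ u v, ∀ᶠ η in 𝓝 (0 : ℝ), ∀ q ∈ stdSimplex ℝ (Fin d → Fin r),
      G.Adj u v → pairInfo q u v ≤ η → c < relEntropy q p := by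
    intro u v
    have hK : IsCompact {q ∈ stdSimplex ℝ (Fin d → Fin r) | relEntropy q p ≤ c} :=
      (isCompact_stdSimplex ℝ _).of_isClosed_subset
        ((isCompact_stdSimplex ℝ _).isClosed.isClosed_le
          (continuous_relEntropy hpos).continuousOn continuousOn_const) fun q hq => hq.1
    rcases Set.eq_empty_or_nonempty {q ∈ stdSimplex ℝ (Fin d → Fin r) | relEntropy q p ≤ c}
      with h0 | h0
    · refine Eventually.of_forall fun η q hq _ _ => ?_
      by_contra hcon
      exact (h0 ▸ (⟨hq, not_lt.1 hcon⟩ :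
        q ∈ {q ∈ stdSimplex ℝ (Fin d → Fin r) | relEntropy q p ≤ c}) : q ∈ (∅ : Set _))
    · obtain ⟨q₀, hq₀, hmin⟩ := hK.exists_isMinOn h0
        ((continuousOn_pairInfo u v).mono fun q hq => hq.1)
      by_cases huv : G.Adj u v
      · have hpos0 : 0 < pairInfo q₀ u v := by
          by_contra hcon
          exact absurd (hc q₀ hq₀.1 (Or.inr ⟨u, v, huv, not_lt.1 hcon⟩)) (not_lt.2 hq₀.2)
        filter_upwards [eventually_lt_nhds hpos0] with η hη q hq _ hle
        by_contra hcon
        exact absurd (hmin ⟨hq, not_lt.1 hcon⟩ : pairInfo q₀ u v ≤ pairInfo q u v)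
          (not_le.2 (hle.trans_lt hη))
      · exact Eventually.of_forall fun η q _ h => absurd h huv
  filter_upwards [eventually_all.2 fun u => eventually_all.2 (h u)] with η hη q hq hcf
  rcases hcf with h1 | ⟨u, v, huv, hle⟩
  · exact hc q hq (Or.inl h1)
  · exact hη u v q hq huv hle

/-- Upper bound for the error probability. -/
theorem sampleProb_error_le {G : SimpleGraph (Fin d)} (hG : G.IsAcyclic)
    (hp : p ∈ stdSimplex ℝ (Fin d → Fin r)) (hpos : ∀ x, 0 < p x)
    (hfar : ∀ i j, ¬G.Reachable i j → ∀ a b, pairLaw p i j a b = nodeLaw p i a * nodeLaw p j b)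
    {n : ℕ} (hn : n ≠ 0) {ε c : ℝ} {Ehat : (Fin n → Fin d → Fin r) → SimpleGraph (Fin d)}
    (hE : ∀ x, IsOutput x ε (Ehat x))
    (hc : ∀ q ∈ stdSimplex ℝ (Fin d → Fin r), IsConfusable G ε q → c < relEntropy q p)
    (hcε : ∀ i j, ¬G.Reachable i j → c ≤ ε) :
    sampleProb p {x | Ehat x ≠ G}
      ≤ ((n : ℝ) + 1) ^ Fintype.card (Fin d → Fin r) * Real.exp (-(n * c)) := by
  refine sampleProb_le_of_relEntropy hn hp.1 fun x hx _ => ?_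
  by_contra hcon
  have hT := empirical_mem_stdSimplex hn x
  have hnc : ¬IsConfusable G ε (empirical x) := fun h => hcon (hc _ hT h).le
  refine hx ((hE x).eq_of_forall hG ?_ ?_ ?_)
  · intro u v huv i hi j hj hne
    by_contra hlt
    refine hnc (Or.inl ⟨u, v, i, j, ⟨huv, hi, hj, hne⟩, ?_⟩)
    rw [pairInfo_empirical, pairInfo_empirical]
    exact not_lt.1 hlt
  · intro u v huv
    by_contra hlt
    refine hnc (Or.inr ⟨u, v, huv, ?_⟩)
    rw [pairInfo_empirical]
    exact not_lt.1 hlt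
  · intro i j hij
    by_contra hlt
    -- A false detection means information at least `ε` for a pair independent under `p`, which
    -- costs divergence at least `ε`. For connected `G` there is no such pair and `c` may exceed
    -- `ε`.
    have h1 := pairInfo_le_relEntropy hp hT (fun x _ => hpos x) (hfar i j hij)
    rw [pairInfo_empirical] at h1
    exact hcon (((hcε i j hij).trans (not_lt.1 hlt)).trans h1)

end Bounds

/-! ### Weakly dependent perturbations of an independent pair -/

section Perturbation

variable {d r : ℕ} {p : (Fin d → Fin r) → ℝ}

/-- A centered indicator; a second letter, with value `-π z`, makes its variance positive. -/
theorem exists_centered (hr : 2 ≤ r) {π : Fin r → ℝ} (hπ : π ∈ stdSimplex ℝ (Fin r))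
    (hpos : ∀ a, 0 < π a) :
    ∃ f : Fin r → ℝ, (∀ a, |f a| ≤ 1) ∧ ∑ a, π a * f a = 0 ∧ 0 < ∑ a, π a * f a ^ 2 := by
  set z : Fin r := ⟨0, by omega⟩
  set o : Fin r := ⟨1, by omega⟩
  have hoz : o ≠ z := by simp [o, z]
  have hle : π z ≤ 1 := by
    rw [← hπ.2]
    exact Finset.single_le_sum (fun a _ => (hpos a).le) (Finset.mem_univ z)
  refine ⟨fun a => (if a = z then 1 else 0) - π z, fun a => ?_, ?_, ?_⟩
  · beta_reduce
    rw [abs_le]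
    split_ifs <;> constructor <;> linarith [hpos z]
  · simp only [mul_sub, mul_ite, mul_one, mul_zero]
    rw [Finset.sum_sub_distrib, ← Finset.sum_mul, hπ.2]
    simp
  · refine Finset.sum_pos' (fun a _ => mul_nonneg (hpos a).le (sq_nonneg _))
      ⟨o, Finset.mem_univ _, mul_pos (hpos o) ?_⟩
    beta_reduce
    rw [if_neg hoz, zero_sub, neg_sq]
    exact pow_pos (hpos z) 2

/-- Close to a distribution under which `i` and `j` are independent there are distributions with
`i` and `j` slightly dependent. -/
theorem exists_perturbation (hr : 2 ≤ r) (hp : p ∈ stdSimplex ℝ (Fin d → Fin r))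
    (hpos : ∀ x, 0 < p x) {i j : Fin d}
    (hind : ∀ a b, pairLaw p i j a b = nodeLaw p i a * nodeLaw p j b) :
    ∃ σ : ℝ, 0 < σ ∧ ∀ t : ℝ, 0 < t → t ≤ 1 / 2 → ∃ q ∈ stdSimplex ℝ (Fin d → Fin r),
      relEntropy q p ≤ t ^ 2 * σ ∧
      ∀ T ∈ stdSimplex ℝ (Fin d → Fin r), (∀ x, 0 < T x → 0 < q x) →
        pairInfo T i j < t ^ 2 * σ ^ 2 / 256 → t ^ 2 * σ ^ 2 / 256 ≤ relEntropy T q := by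
  have hnode : ∀ k a, 0 < nodeLaw p k a := fun k a => by
    have := marg_pos hpos {k} fun _ => a
    rwa [marg_singleton] at this
  obtain ⟨f, hf1, hf0, hf2⟩ := exists_centered hr (nodeLaw_mem_stdSimplex hp i) (hnode i)
  obtain ⟨g, hg1, hg0, hg2⟩ := exists_centered hr (nodeLaw_mem_stdSimplex hp j) (hnode j)
  have hprod : ∀ F H : Fin r → ℝ, ∑ x, p x * (F (x i) * H (x j))
      = (∑ a, nodeLaw p i a * F a) * ∑ b, nodeLaw p j b * H b := fun F H => by
    rw [← sum_pairLaw_mul p i j fun a b => F a * H b, Finset.sum_mul_sum]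
    refine Finset.sum_congr rfl fun a _ => Finset.sum_congr rfl fun b _ => ?_
    rw [hind]; ring
  set σ := (∑ a, nodeLaw p i a * f a ^ 2) * ∑ b, nodeLaw p j b * g b ^ 2 with hσ
  have hσpos : 0 < σ := mul_pos hf2 hg2
  refine ⟨σ, hσpos, fun t ht0 ht => ?_⟩
  have hfg : ∀ x : Fin d → Fin r, |f (x i) * g (x j)| ≤ 1 := fun x => by
    rw [abs_mul]; exact mul_le_one₀ (hf1 _) (abs_nonneg _) (hg1 _)
  have h1pos : ∀ x : Fin d → Fin r, 0 < 1 + t * (f (x i) * g (x j)) := fun x => by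
    have := (abs_le.1 (hfg x)).1
    nlinarith
  -- Under `q` the covariance of `f` and `g` is `t * σ`, while `D(q ‖ p) ≤ t ^ 2 * σ` by `log (1 +
  -- s) ≤ s`.
  set q : (Fin d → Fin r) → ℝ := fun x => p x * (1 + t * (f (x i) * g (x j))) with hq
  have hE : ∀ φ : (Fin d → Fin r) → ℝ, ∑ x, q x * φ x
      = ∑ x, p x * φ x + t * ∑ x, p x * (f (x i) * g (x j) * φ x) := fun φ => by
    rw [Finset.mul_sum, ← Finset.sum_add_distrib]
    exact Finset.sum_congr rfl fun x _ => by simp only [hq]; ring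
  have hEfg0 : ∑ x, p x * (f (x i) * g (x j)) = 0 := by rw [hprod f g, hf0, zero_mul]
  have hqmem : q ∈ stdSimplex ℝ (Fin d → Fin r) := by
    refine ⟨fun x => (mul_pos (hpos x) (h1pos x)).le, ?_⟩
    have := hE fun _ => 1
    simp only [mul_one] at this
    rw [this, hp.2, hEfg0]
    ring
  have hEfg : ∑ x, q x * (f (x i) * g (x j)) = t * σ := by
    rw [hE, hEfg0, zero_add, hσ, ← hprod (fun a => f a ^ 2) fun b => g b ^ 2]
    congr 1
    exact Finset.sum_congr rfl fun x _ => by ring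
  have hEf : ∑ x, q x * f (x i) = 0 := by
    rw [hE, ← sum_nodeLaw_mul, hf0]
    have := hprod (fun a => f a ^ 2) g
    rw [hg0, mul_zero] at this
    rw [Finset.sum_congr rfl (g := fun x => p x * (f (x i) ^ 2 * g (x j))) fun x _ => by ring, this]
    ring
  refine ⟨q, hqmem, ?_, fun T hT hTq hI => ?_⟩
  · have : t ^ 2 * σ = ∑ x, q x * (t * (f (x i) * g (x j))) := by
      rw [Finset.sum_congr rfl (g := fun x => t * (q x * (f (x i) * g (x j)))) fun x _ => by ring,
        ← Finset.mul_sum, hEfg]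
      ring
    rw [this]
    refine Finset.sum_le_sum fun x _ => mul_le_mul_of_nonneg_left ?_ (hqmem.1 x)
    have h2 : q x / p x = 1 + t * (f (x i) * g (x j)) := by
      simp only [hq]
      rw [mul_div_cancel_left₀ _ (hpos x).ne']
    rw [h2]
    linarith [Real.log_le_sub_one_of_pos (h1pos x)]
  · by_contra hcon
    have hD := not_le.1 hcon
    -- The constant is `256 = 16 * 4 ^ 2`: each of three Pinsker errors is below a quarter of `t *
    -- σ`, and together they would have to make up `t * σ`.
    have hbound : ∀ {y B : ℝ}, y ^ 2 / 16 ≤ B → B < t ^ 2 * σ ^ 2 / 256 → |y| < t * σ / 4 := by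
      intro y B h1 h2
      refine abs_lt_of_sq_lt_sq ?_ (by positivity)
      nlinarith
    have b1 := hbound (sq_sub_le_relEntropy hT hqmem hTq hfg) hD
    have b2 := hbound (sq_sub_le_relEntropy hT hqmem hTq (φ := fun x => f (x i)) fun x => hf1 _) hD
    have b3 := hbound (sq_sub_le_pairInfo hT i j hf1 hg1) hI
    rw [hEfg] at b1
    rw [hEf, sub_zero] at b2
    have b4 : |∑ x, T x * g (x j)| ≤ 1 := by
      calc |∑ x, T x * g (x j)| ≤ ∑ x, |T x * g (x j)| := Finset.abs_sum_le_sum_abs _ _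
        _ ≤ ∑ x, T x := Finset.sum_le_sum fun x _ => by
            rw [abs_mul, abs_of_nonneg (hT.1 x)]
            exact mul_le_of_le_one_right (hT.1 x) (hg1 _)
        _ = 1 := hT.2
    have b5 : |(∑ x, T x * f (x i)) * ∑ x, T x * g (x j)| < t * σ / 4 := by
      rw [abs_mul]
      exact (mul_le_of_le_one_right (abs_nonneg _) b4).trans_lt b2
    have c1 := abs_lt.1 b1
    have c3 := abs_lt.1 b3
    have c5 := abs_lt.1 b5
    have := mul_pos ht0 hσpos
    linarith

end Perturbation


/-! ### Error exponents for forests and trees -/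

section ErrorRate

variable {d r : ℕ} {P : Measure (Fin d → Fin r)} [IsProbabilityMeasure P]
  {G : SimpleGraph (Fin d)}

theorem logErrorProb_eq (Ehat : (n : ℕ) → (Fin n → Fin d → Fin r) → SimpleGraph (Fin d)) (n : ℕ) :
    logErrorProb P G Ehat n
      = ENNReal.log (ENNReal.ofReal (sampleProb (massFun P) {x | Ehat n x ≠ G})) := by
  rw [logErrorProb, measure_pi_eq_sampleProb]

theorem IsForestModel.not_isConfusable (h : IsForestModel P G) :
    ¬IsConfusable G 0 (massFun P) := by
  rintro (⟨u, v, i, j, ⟨huv, hi, hj, hne⟩, hle⟩ | ⟨u, v, huv, hle⟩)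
  · exact absurd (h.pairInfo_lt huv hi hj hne) (not_lt.2 hle)
  · exact absurd (h.pairInfo_pos huv) (not_lt.2 hle)

theorem IsForestModel.relEntropy_pos (h : IsForestModel P G) {q : (Fin d → Fin r) → ℝ}
    (hq : q ∈ stdSimplex ℝ (Fin d → Fin r)) (hc : IsConfusable G 0 q) :
    0 < relEntropy q (massFun P) := by
  by_contra hcon
  have := eq_of_relEntropy_nonpos hq massFun_mem_stdSimplex (fun x _ => h.massFun_pos x)
    (not_lt.1 hcon)
  exact h.not_isConfusable (this ▸ hc)

/-- The confusable laws are a compact set that misses `P`; half the minimal divergence makes the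
inequality strict. -/
theorem IsForestModel.exists_gap (h : IsForestModel P G) :
    ∃ c : ℝ, 0 < c ∧ ∀ q ∈ stdSimplex ℝ (Fin d → Fin r), IsConfusable G 0 q →
      c < relEntropy q (massFun P) := by
  rcases Set.eq_empty_or_nonempty {q | q ∈ stdSimplex ℝ (Fin d → Fin r) ∧ IsConfusable G 0 q}
    with h0 | h0
  · exact ⟨1, one_pos, fun q hq hc => absurd (Set.mem_empty_iff_false q |>.1 (h0 ▸ ⟨hq, hc⟩)) id⟩
  · obtain ⟨q₀, hq₀, hmin⟩ := (isCompact_confusable G 0).exists_isMinOn h0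
      (continuous_relEntropy h.massFun_pos).continuousOn
    have hpos := h.relEntropy_pos hq₀.1 hq₀.2
    refine ⟨relEntropy q₀ (massFun P) / 2, by positivity, fun q hq hc => ?_⟩
    have : relEntropy q₀ (massFun P) ≤ relEntropy q (massFun P) := hmin ⟨hq, hc⟩
    linarith

/-- Once `ε n` is below the gap, false detections are the cheapest errors, so Sanov's bound holds
with exponent `ε n`. -/
theorem IsForestModel.limsup_le (h : IsForestModel P G)
    {ε : ℕ → ℝ} (hε : IsRegularization ε)
    {Ehat : (n : ℕ) → (Fin n → Fin d → Fin r) → SimpleGraph (Fin d)}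
    (hE : IsImplementation ε Ehat) :
    limsup (fun n : ℕ => ((1 / (n * ε n) : ℝ) : EReal) * logErrorProb P G Ehat n) atTop
      ≤ ((-1 : ℝ) : EReal) := by
  obtain ⟨c, hc0, hc⟩ := h.exists_gap
  set N : ℕ := Fintype.card (Fin d → Fin r)
  have hlim : Tendsto (fun n : ℕ => ((N * (Real.log (n + 1) / (n * ε n)) - 1 : ℝ) : EReal)) atTop
      (𝓝 ((-1 : ℝ) : EReal)) := by
    refine (continuous_coe_real_ereal.tendsto (-1)).comp ?_
    simpa using (hε.tendsto_log_div.const_mul (N : ℝ)).sub_const 1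
  rw [← hlim.limsup_eq]
  refine limsup_le_limsup ?_
  filter_upwards [hε.1.eventually (eventually_lt_relEntropy h.massFun_pos hc),
    hε.1.eventually (eventually_lt_nhds hc0), hε.tendsto_mul.eventually_gt_atTop 0,
    eventually_ne_atTop 0] with n h1 h2 h3 hn
  have hle := sampleProb_error_le h.acyclic massFun_mem_stdSimplex h.massFun_pos
    (fun i j hij => h.pairLaw_eq_mul hij) hn (hE n) (c := ε n)
    (fun q hq hq' => h2.trans (h1 q hq hq')) (fun _ _ _ => le_rfl)
  change _ ≤ ((n : ℝ) + 1) ^ N * _ at hle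
  rw [pow_mul_exp_eq] at hle
  rw [logErrorProb_eq]
  refine (mul_log_ofReal_le (one_div_pos.2 h3) hle).trans (le_of_eq ?_)
  congr 1
  rw [mul_sub, one_div_mul_cancel h3.ne']
  ring

theorem IsForestModel.exists_le_liminf (hr : 2 ≤ r) (h : IsForestModel P G) {i j : Fin d}
    (hij : ¬G.Reachable i j) :
    ∃ C : ℝ, 1 < C ∧ ∀ ε : ℕ → ℝ, IsRegularization ε →
      ∀ Ehat : (n : ℕ) → (Fin n → Fin d → Fin r) → SimpleGraph (Fin d), IsImplementation ε Ehat →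
        ((-C : ℝ) : EReal)
          ≤ liminf (fun n : ℕ => ((1 / (n * ε n) : ℝ) : EReal) * logErrorProb P G Ehat n) atTop := by
  have hmem := massFun_mem_stdSimplex (P := P)
  obtain ⟨σ, hσ, hpert⟩ := exists_perturbation hr hmem h.massFun_pos (h.pairLaw_eq_mul hij)
  -- The perturbation below has divergence at most `512 * ε n / σ`, doubled because its typical
  -- event is only known to have probability at least 1/2; the summand 1 ensures `1 < C`.
  refine ⟨1024 / σ + 1, by simpa using hσ, fun ε hε Ehat hE => ?_⟩
  set N : ℕ := Fintype.card (Fin d → Fin r)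
  have hlim : Tendsto (fun n : ℕ => ((-(1024 / σ) - 2 * Real.log 2 * (n * ε n)⁻¹ : ℝ) : EReal))
      atTop (𝓝 ((-(1024 / σ) : ℝ) : EReal)) := by
    refine (continuous_coe_real_ereal.tendsto _).comp ?_
    simpa using ((tendsto_inv_atTop_zero.comp hε.tendsto_mul).const_mul
      (2 * Real.log 2)).const_sub (-(1024 / σ))
  have hC : ((-(1024 / σ + 1) : ℝ) : EReal) ≤ ((-(1024 / σ) : ℝ) : EReal) :=
    EReal.coe_le_coe_iff.2 (by linarith)
  refine hC.trans ?_
  rw [← hlim.liminf_eq]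
  refine liminf_le_liminf ?_
  have hsmall : (0 : ℝ) < σ ^ 2 / 2048 := by positivity
  filter_upwards [hε.1.eventually (eventually_lt_nhds hsmall), hε.eventually_pos,
    hε.tendsto_mul.eventually_gt_atTop 0, eventually_ne_atTop 0,
    (hε.tendsto_pow_mul_exp N).eventually (eventually_lt_nhds (by norm_num : (0 : ℝ) < 1 / 2))]
    with n h1 h2 h3 hn h5
  -- Chosen so that `t ^ 2 * σ ^ 2 / 256 = 2 * ε n`; the factor 2 turns `pairInfo T i j ≤ ε n` into
  -- the strict inequality required. The bound `ε n < σ ^ 2 / 2048` gives `t ≤ 1 / 2`.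
  set t : ℝ := √(512 * ε n / σ ^ 2) with ht
  have ht2 : t ^ 2 = 512 * ε n / σ ^ 2 := Real.sq_sqrt (by positivity)
  have ht0 : 0 < t := Real.sqrt_pos.2 (by positivity)
  have htle : t ≤ 1 / 2 := by
    refine abs_le_of_sq_le_sq' ?_ (by norm_num) |>.2
    rw [ht2, div_le_iff₀ (by positivity)]
    linarith
  obtain ⟨q, hq, hqp, hT⟩ := hpert t ht0 htle
  have h256 : t ^ 2 * σ ^ 2 / 256 = 2 * ε n := by
    rw [ht2]; field_simp; norm_num
  rw [h256] at hT
  have hs := one_sub_le_sampleProb hq hn {T | ε n < pairInfo T i j} (c := ε n)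
    fun T hTm hTq hTU => by
      have : pairInfo T i j ≤ ε n := not_lt.1 hTU
      linarith [hT T hTm hTq (by linarith)]
  have hsub : {x : Fin n → Fin d → Fin r | empirical x ∈ {T | ε n < pairInfo T i j}}
      ⊆ {x | Ehat n x ≠ G} := by
    intro x hx heq
    have h6 := hE n x
    rw [heq] at h6
    have h7 := h6.le_of_not_reachable hij
    rw [← pairInfo_empirical] at h7
    exact absurd (show ε n < pairInfo (empirical x) i j from hx) (not_lt.2 h7)
  obtain ⟨ha, hlow⟩ := le_log_sampleProb hmem h.massFun_pos hq hsub
    (by norm_num : (0 : ℝ) < 1 / 2) (by linarith)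
  rw [logErrorProb_eq]
  refine le_trans (EReal.coe_le_coe_iff.2 ?_) (le_mul_log_ofReal (one_div_pos.2 h3).le ha hlow)
  have h8 : n * relEntropy q (massFun P) ≤ n * ε n * (512 / σ) := by
    refine (mul_le_mul_of_nonneg_left hqp (Nat.cast_nonneg n)).trans (le_of_eq ?_)
    rw [ht2]; field_simp
  have h9 : 1 / (n * ε n) * -((n * ε n * (512 / σ) + Real.log 2) / (1 / 2))
      = -(1024 / σ) - 2 * Real.log 2 * (n * ε n)⁻¹ := by
    field_simp
    ring
  rw [← h9]
  refine mul_le_mul_of_nonneg_left (neg_le_neg ?_) (one_div_pos.2 h3).le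
  exact div_le_div_of_nonneg_right (by linarith) (by norm_num)

/-- Exponential lower bound from events that are typical under `q`. -/
theorem eventually_lt_of_typical {p q : (Fin d → Fin r) → ℝ}
    (hp : p ∈ stdSimplex ℝ (Fin d → Fin r)) (hpos : ∀ x, 0 < p x)
    (hq : q ∈ stdSimplex ℝ (Fin d → Fin r)) {S A : (n : ℕ) → Set (Fin n → Fin d → Fin r)}
    (hSA : ∀ᶠ n in atTop, S n ⊆ A n) {g : ℕ → ℝ} (hg : Tendsto g atTop (𝓝 0))
    (hS : ∀ᶠ n in atTop, 1 - g n ≤ sampleProb q (S n)) {b : ℝ} (hb : b < -relEntropy q p) :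
    ∀ᶠ n : ℕ in atTop, (b : EReal)
      < ((1 / n : ℝ) : EReal) * ENNReal.log (ENNReal.ofReal (sampleProb p (A n))) := by
  have hlim : Tendsto (fun n : ℕ => -((relEntropy q p + Real.log 2 * (n : ℝ)⁻¹) / (1 - g n))) atTop
      (𝓝 (-relEntropy q p)) := by
    have h1 : Tendsto (fun n : ℕ => relEntropy q p + Real.log 2 * (n : ℝ)⁻¹) atTop
        (𝓝 (relEntropy q p + Real.log 2 * 0)) :=
      ((tendsto_inv_atTop_zero.comp tendsto_natCast_atTop_atTop).const_mul _).const_add _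
    have h2 : Tendsto (fun n => 1 - g n) atTop (𝓝 (1 - 0)) := hg.const_sub 1
    have h3 := (h1.div h2 (by norm_num)).neg
    simpa using h3
  filter_upwards [hSA, hS, hlim.eventually (eventually_gt_nhds hb), eventually_ne_atTop 0,
    hg.eventually (eventually_lt_nhds one_pos)] with n h1 h2 h3 hn h5
  obtain ⟨ha, hlow⟩ := le_log_sampleProb hp hpos hq h1 (sub_pos.2 h5) h2
  refine lt_of_lt_of_le (EReal.coe_lt_coe_iff.2 ?_)
    (le_mul_log_ofReal (by positivity) ha hlow)
  refine h3.trans_le (le_of_eq ?_)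
  have hs := (sub_pos.2 h5).ne'
  have hn' : (n : ℝ) ≠ 0 := Nat.cast_ne_zero.2 hn
  field_simp

/-- The strict inequality persists in a ball of radius `δ` around `q`; outside it some mass differs
by at least `δ`, and Pinsker's inequality gives `δ ^ 2 / 16`. -/
theorem exists_le_relEntropy_of_pairInfo_le {q : (Fin d → Fin r) → ℝ}
    (hq : q ∈ stdSimplex ℝ (Fin d → Fin r)) {u v i j : Fin d}
    (hlt : pairInfo q u v < pairInfo q i j) :
    ∃ c : ℝ, 0 < c ∧ ∀ T ∈ stdSimplex ℝ (Fin d → Fin r), (∀ x, 0 < T x → 0 < q x) →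
      pairInfo T i j ≤ pairInfo T u v → c ≤ relEntropy T q := by
  classical
  have hev : ∀ᶠ T in 𝓝[stdSimplex ℝ (Fin d → Fin r)] q, pairInfo T u v < pairInfo T i j :=
    (continuousOn_pairInfo u v q hq).eventually_lt (continuousOn_pairInfo i j q hq) hlt
  obtain ⟨δ, hδ, hball⟩ := Metric.mem_nhdsWithin_iff.1 hev
  refine ⟨δ ^ 2 / 16, by positivity, fun T hT hTq hle => ?_⟩
  have hdist : ¬dist T q < δ := fun hd => absurd (hball ⟨hd, hT⟩) (not_lt.2 hle)
  rw [dist_pi_lt_iff hδ] at hdist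
  push Not at hdist
  obtain ⟨x, hx⟩ := hdist
  refine le_trans ?_ (sq_apply_sub_le_relEntropy hT hq hTq x)
  rw [Real.dist_eq] at hx
  have := pow_le_pow_left₀ hδ.le hx 2
  rw [sq_abs] at this
  linarith

/-- The lower bound when an edge is weaker than a competing pair. -/
theorem IsForestModel.eventually_lt_of_pairInfo_lt (h : IsForestModel P G) (hG : G.IsTree)
    {u v i j : Fin d} (huv : G.Adj u v) (hi : i ∈ side G u v) (hj : j ∉ side G u v)
    {q : (Fin d → Fin r) → ℝ} (hq : q ∈ stdSimplex ℝ (Fin d → Fin r))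
    (hlt : pairInfo q u v < pairInfo q i j) {ε : ℕ → ℝ} (hε : IsRegularization ε)
    {Ehat : (n : ℕ) → (Fin n → Fin d → Fin r) → SimpleGraph (Fin d)}
    (hE : IsImplementation ε Ehat) {b : ℝ} (hb : b < -relEntropy q (massFun P)) :
    ∀ᶠ n : ℕ in atTop, (b : EReal) < ((1 / n : ℝ) : EReal) * logErrorProb P G Ehat n := by
  obtain ⟨c, hc, hT⟩ := exists_le_relEntropy_of_pairInfo_le hq hlt
  simp only [logErrorProb_eq]
  refine eventually_lt_of_typical massFun_mem_stdSimplex h.massFun_pos hq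
    (S := fun n => {x | empirical x ∈ {T | pairInfo T u v < pairInfo T i j}}) (A := fun n => {x | Ehat n x ≠ G})
    (Eventually.of_forall fun n x hx heq => ?_)
    (hε.tendsto_pow_mul_exp (Fintype.card (Fin d → Fin r))) ?_ hb
  · have h6 := hE n x
    rw [heq] at h6
    have h7 := h6.le_of_side hG huv hi hj
    rw [← pairInfo_empirical, ← pairInfo_empirical] at h7
    exact absurd (show pairInfo (empirical x) u v < pairInfo (empirical x) i j from hx)
      (not_lt.2 h7)
  · filter_upwards [hε.1.eventually (eventually_lt_nhds hc), eventually_ne_atTop 0] with n h1 hn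
    exact one_sub_le_sampleProb hq hn _ fun T hTm hTq hTU =>
      h1.le.trans (hT T hTm hTq (not_lt.1 hTU))

/-- The lower bound when the ends of an edge are independent. -/
theorem IsForestModel.eventually_lt_of_pairInfo_nonpos (h : IsForestModel P G) {u v : Fin d}
    (huv : G.Adj u v) {q : (Fin d → Fin r) → ℝ} (hq : q ∈ stdSimplex ℝ (Fin d → Fin r))
    (h0 : pairInfo q u v ≤ 0) {ε : ℕ → ℝ} (hε : IsRegularization ε)
    {Ehat : (n : ℕ) → (Fin n → Fin d → Fin r) → SimpleGraph (Fin d)}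
    (hE : IsImplementation ε Ehat) {b : ℝ} (hb : b < -relEntropy q (massFun P)) :
    ∀ᶠ n : ℕ in atTop, (b : EReal) < ((1 / n : ℝ) : EReal) * logErrorProb P G Ehat n := by
  simp only [logErrorProb_eq]
  refine eventually_lt_of_typical massFun_mem_stdSimplex h.massFun_pos hq
    (S := fun n => {x | empirical x ∈ {T | pairInfo T u v < ε n}}) (A := fun n => {x | Ehat n x ≠ G})
    (Eventually.of_forall fun n x hx heq => ?_)
    (hε.tendsto_pow_mul_exp (Fintype.card (Fin d → Fin r))) ?_ hb
  · have h6 := hE n x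
    rw [heq] at h6
    have h7 := h6.le_of_adj huv
    rw [← pairInfo_empirical] at h7
    exact absurd (show pairInfo (empirical x) u v < ε n from hx) (not_lt.2 h7)
  -- Independence under `q` bounds the empirical information by `D(T ‖ q)`, so reaching `ε n` is
  -- atypical and the algorithm typically misses the edge.
  · filter_upwards [eventually_ne_atTop 0] with n hn
    exact one_sub_le_sampleProb hq hn _ fun T hTm hTq hTU => (not_lt.1 hTU).trans
      (pairInfo_le_relEntropy hq hTm hTq (pairLaw_eq_mul_of_pairInfo_nonpos hq h0))

/-- A tie between an edge and a competing pair can be broken by an arbitrarily small change. -/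
theorem exists_pairInfo_lt {p q : (Fin d → Fin r) → ℝ} (hpos : ∀ x, 0 < p x)
    (hq : q ∈ stdSimplex ℝ (Fin d → Fin r)) {u v i j : Fin d} (huv : u ≠ v) (hij : i ≠ j)
    (hne : s(i, j) ≠ s(u, v)) (h0 : 0 < pairInfo q u v) (hle : pairInfo q u v ≤ pairInfo q i j)
    {K : ℝ} (hK : relEntropy q p < K) :
    ∃ q' ∈ stdSimplex ℝ (Fin d → Fin r), pairInfo q' u v < pairInfo q' i j ∧
      relEntropy q' p < K := by
  -- As the pairs differ, one end of `u v` lies outside `{i, j}`. Resampling it leaves the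
  -- information of `i, j` unchanged and strictly lowers that of `u, v`.
  wlog hv : v ≠ i ∧ v ≠ j generalizing u v
  · have hu : u ≠ i ∧ u ≠ j := by
      by_contra hcon
      refine hne ?_
      rw [not_and_or, not_not, not_not] at hv hcon
      rw [Sym2.eq_iff]
      rcases hv with hv | hv <;> rcases hcon with hu | hu <;> subst hv <;> subst hu <;> simp_all
    obtain ⟨q', h1, h2, h3⟩ := this huv.symm (by rwa [Sym2.eq_swap (a := v)])
      (by rwa [pairInfo_comm]) (by rwa [pairInfo_comm q v u]) hu
    exact ⟨q', h1, by rwa [pairInfo_comm], h3⟩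
  have hcont : Tendsto (fun t : ℝ => relEntropy ((1 - t) • q + t • resample q v) p) (𝓝[>] 0)
      (𝓝 (relEntropy q p)) := by
    have hc : Continuous fun t : ℝ => relEntropy ((1 - t) • q + t • resample q v) p :=
      (continuous_relEntropy hpos).comp (by fun_prop)
    have := hc.tendsto 0
    simp only [sub_zero, one_smul, zero_smul, add_zero] at this
    exact this.mono_left nhdsWithin_le_nhds
  obtain ⟨t, h1, h2, h3⟩ := ((hcont.eventually (eventually_lt_nhds hK)).and
    (Ioo_mem_nhdsGT (one_pos (α := ℝ)))).exists
  refine ⟨_, convex_stdSimplex ℝ _ hq (resample_mem_stdSimplex hq v) (sub_nonneg.2 h3.le) h2.le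
    (by ring), ?_, h1⟩
  rw [pairInfo_mix_resample_of_ne hq hv.1.symm hv.2.symm]
  refine (pairInfo_mix_resample_le hq huv h2.le h3.le).trans_lt (lt_of_lt_of_le ?_ hle)
  nlinarith

/-- The exponent is the minimal divergence over the confusable laws at threshold 0. That set is
nonempty for `d ≥ 2`: resampling an end of an edge makes the edge independent. -/
theorem IsForestModel.exists_tendsto (h : IsForestModel P G) (hG : G.IsTree) (hd : 2 ≤ d)
    {ε : ℕ → ℝ} (hε : IsRegularization ε)
    {Ehat : (n : ℕ) → (Fin n → Fin d → Fin r) → SimpleGraph (Fin d)}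
    (hE : IsImplementation ε Ehat) :
    ∃ K : ℝ, 0 < K ∧ Tendsto (fun n : ℕ => ((1 / n : ℝ) : EReal) * logErrorProb P G Ehat n) atTop
      (𝓝 ((-K : ℝ) : EReal)) := by
  have hmem := massFun_mem_stdSimplex (P := P)
  have hne : {q | q ∈ stdSimplex ℝ (Fin d → Fin r) ∧ IsConfusable G 0 q}.Nonempty := by
    have : Nontrivial (Fin d) := Fin.nontrivial_iff_two_le.2 hd
    obtain ⟨v, hv⟩ := hG.connected.preconnected.exists_adj_of_nontrivial ⟨0, by omega⟩
    have hle := pairInfo_mix_resample_le hmem hv.ne zero_le_one le_rfl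
    simp only [sub_self, zero_smul, one_smul, zero_add, zero_mul] at hle
    exact ⟨_, resample_mem_stdSimplex hmem v, Or.inr ⟨_, v, hv, hle⟩⟩
  obtain ⟨q, ⟨hq, hcf⟩, hmin⟩ := (isCompact_confusable G 0).exists_isMinOn hne
    (continuous_relEntropy h.massFun_pos).continuousOn
  set K := relEntropy q (massFun P) with hK
  have hKpos : 0 < K := h.relEntropy_pos hq hcf
  refine ⟨K, hKpos, tendsto_order.2 ⟨fun a ha => ?_, fun a ha => ?_⟩⟩
  · obtain ⟨b, hab, hb⟩ := EReal.lt_iff_exists_real_btwn.1 ha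
    have hbK : b < -K := EReal.coe_lt_coe_iff.1 hb
    suffices ∀ᶠ n : ℕ in atTop, (b : EReal) < ((1 / n : ℝ) : EReal) * logErrorProb P G Ehat n by
      filter_upwards [this] with n hn using hab.trans hn
    -- An independent edge of the minimizer is dropped by thresholding. Otherwise a competing pair
    -- is at least as strong as an edge of positive information, and a slight perturbation makes it
    -- strictly stronger.
    by_cases hex : ∃ u v, G.Adj u v ∧ pairInfo q u v ≤ 0
    · obtain ⟨u, v, huv, h0⟩ := hex
      exact h.eventually_lt_of_pairInfo_nonpos huv hq h0 hε hE hbK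
    · rcases hcf with ⟨u, v, i, j, ⟨huv, hi, hj, hne⟩, hle⟩ | hcf
      · have h0 : 0 < pairInfo q u v := by
          by_contra hcon
          exact hex ⟨u, v, huv, not_lt.1 hcon⟩
        obtain ⟨q', hq', hlt, hK'⟩ := exists_pairInfo_lt h.massFun_pos hq huv.ne
          (fun he : i = j => hj (he ▸ hi)) hne h0 hle (lt_neg_of_lt_neg hbK)
        exact h.eventually_lt_of_pairInfo_lt hG huv hi hj hq' hlt hε hE (lt_neg_of_lt_neg hK')
      · exact absurd hcf hex
  · obtain ⟨b, hb, hba⟩ := EReal.lt_iff_exists_real_btwn.1 ha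
    have hbK : -K < b := EReal.coe_lt_coe_iff.1 hb
    set c := (K - b) / 2 with hc
    have hcK : c < K := by rw [hc]; linarith
    have hbc : -c < b := by rw [hc]; linarith
    set N : ℕ := Fintype.card (Fin d → Fin r)
    have hlim : Tendsto (fun n : ℕ => N * (Real.log (n + 1) / n) - c) atTop (𝓝 (-c)) := by
      simpa using (tendsto_log_succ_div.const_mul (N : ℝ)).sub_const c
    have hcl : ∀ q ∈ stdSimplex ℝ (Fin d → Fin r), IsConfusable G 0 q →
        c < relEntropy q (massFun P) := fun q' hq' hcf' =>
      hcK.trans_le (hmin ⟨hq', hcf'⟩)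
    filter_upwards [hε.1.eventually (eventually_lt_relEntropy h.massFun_pos hcl),
      hlim.eventually (eventually_lt_nhds hbc), eventually_gt_atTop 0] with n h1 h2 hn
    have hle := sampleProb_error_le h.acyclic hmem h.massFun_pos
      (fun i j hij => h.pairLaw_eq_mul hij) hn.ne' (hE n) h1
      (fun i j hij => absurd (hG.connected.preconnected i j) hij)
    change _ ≤ ((n : ℝ) + 1) ^ N * _ at hle
    rw [pow_mul_exp_eq] at hle
    rw [logErrorProb_eq]
    have hn' : (0 : ℝ) < n := Nat.cast_pos.2 hn
    refine (mul_log_ofReal_le (one_div_pos.2 hn') hle).trans_lt (lt_trans ?_ hba)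
    refine EReal.coe_lt_coe_iff.2 (lt_of_eq_of_lt ?_ h2)
    rw [mul_sub, ← mul_assoc (1 / (n : ℝ)) n c, one_div_mul_cancel hn'.ne']
    ring

end ErrorRate


/-! ### Edge counts of forests and the main theorem -/

theorem exists_not_reachable_of_ncard_lt {d : ℕ} {G : SimpleGraph (Fin d)}
    (h : G.edgeSet.ncard + 1 < d) : ∃ i j, ¬G.Reachable i j := by
  by_contra hcon
  push Not at hcon
  have : Nonempty (Fin d) := ⟨⟨0, by omega⟩⟩
  have hconn : G.Connected := ⟨hcon⟩
  have := hconn.card_vert_le_card_edgeSet_add_one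
  rw [Nat.card_fin, Nat.card_coe_set_eq] at this
  omega

theorem isTree_of_isAcyclic_of_ncard {d : ℕ} {G : SimpleGraph (Fin d)} (hG : G.IsAcyclic)
    (h : G.edgeSet.ncard + 1 = d) : G.IsTree := by
  have : Nonempty (Fin d) := ⟨⟨0, by omega⟩⟩
  obtain ⟨F, hle, -, hF⟩ :=
    (SimpleGraph.connected_top (V := Fin d)).exists_isTree_le_of_le_of_isAcyclic le_top hG
  have h1 := (SimpleGraph.isTree_iff_connected_and_card.1 hF).2
  rw [Nat.card_fin, Nat.card_coe_set_eq] at h1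
  have h2 := Set.eq_of_subset_of_ncard_le (SimpleGraph.edgeSet_subset_edgeSet.2 hle) (by omega)
    (Set.toFinite _)
  rw [SimpleGraph.edgeSet_inj.1 h2]
  exact hF

end CLThres

theorem mainTheorem1 {d r : ℕ} (hr : 2 ≤ r)
    (P : Measure (Fin d → Fin r)) [IsProbabilityMeasure P]
    (G : SimpleGraph (Fin d)) (hP : CLThres.IsForestModel P G) :
    (G.edgeSet.ncard + 1 < d →
      ∃ C : ℝ, 1 < C ∧
        ∀ ε : ℕ → ℝ, CLThres.IsRegularization ε →
        ∀ Ehat : (n : ℕ) → (Fin n → Fin d → Fin r) → SimpleGraph (Fin d),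
          CLThres.IsImplementation ε Ehat →
          ((-C : ℝ) : EReal) ≤
              liminf (fun n : ℕ => ((1 / (n * ε n) : ℝ) : EReal) *
                CLThres.logErrorProb P G Ehat n) atTop ∧
            liminf (fun n : ℕ => ((1 / (n * ε n) : ℝ) : EReal) *
                CLThres.logErrorProb P G Ehat n) atTop ≤
              limsup (fun n : ℕ => ((1 / (n * ε n) : ℝ) : EReal) *
                CLThres.logErrorProb P G Ehat n) atTop ∧
            limsup (fun n : ℕ => ((1 / (n * ε n) : ℝ) : EReal) *
                CLThres.logErrorProb P G Ehat n) atTop ≤ ((-1 : ℝ) : EReal)) ∧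
    (G.edgeSet.ncard + 1 = d →
      ∀ ε : ℕ → ℝ, CLThres.IsRegularization ε →
      ∀ Ehat : (n : ℕ) → (Fin n → Fin d → Fin r) → SimpleGraph (Fin d),
        CLThres.IsImplementation ε Ehat →
        ∃ L : EReal, L < 0 ∧ (2 ≤ d → L ≠ ⊥) ∧
          Tendsto (fun n : ℕ => ((1 / n : ℝ) : EReal) *
            CLThres.logErrorProb P G Ehat n) atTop (𝓝 L)) := by
  refine ⟨fun hk => ?_, fun hk ε hε Ehat hE => ?_⟩
  · obtain ⟨i, j, hij⟩ := CLThres.exists_not_reachable_of_ncard_lt hk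
    obtain ⟨C, hC1, hC⟩ := hP.exists_le_liminf hr hij
    exact ⟨C, hC1, fun ε hε Ehat hE => ⟨hC ε hε Ehat hE, liminf_le_limsup,
      hP.limsup_le hε hE⟩⟩
  · rcases le_or_gt 2 d with hd | hd
    · obtain ⟨K, hK, hlim⟩ :=
        hP.exists_tendsto (CLThres.isTree_of_isAcyclic_of_ncard hP.acyclic hk) hd hε hE
      exact ⟨_, by exact_mod_cast neg_neg_of_pos hK, fun _ => EReal.coe_ne_bot _, hlim⟩
    · have : Subsingleton (Fin d) := Fin.subsingleton_iff_le_one.2 (by omega)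
      refine ⟨⊥, EReal.bot_lt_zero, fun h => absurd h (not_le.2 hd), ?_⟩
      refine tendsto_const_nhds.congr' ?_
      -- At `n = 0` the factor `1 / n` is 0 and its product with `⊥` is 0, so this index is
      -- excluded.
      filter_upwards [eventually_gt_atTop 0] with n hn
      have hempty : {x : Fin n → Fin d → Fin r | Ehat n x ≠ G} = ∅ :=
        Set.eq_empty_of_forall_notMem fun x hx => hx (Subsingleton.elim _ _)
      rw [CLThres.logErrorProb, hempty, measure_empty, ENNReal.log_zero,
        EReal.coe_mul_bot_of_pos (one_div_pos.2 (Nat.cast_pos.2 hn))]
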